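/- **Setting.** Let $\mathcal H_S,\mathcal H_E$ be complex Hilbert spaces (system and environment), $\mathcal H=\mathcal H_S\otimes\mathcal H_E$ their Hilbert tensor product, and let $\hat H_S,\hat H_E$ be self-adjoint operators in $\mathcal H_S,\mathcal H_E$. Let $\hat S_1,\dots,\hat S_m$ and $\hat E_1,\dots,\hat E_m$ be self-adjoint operators in $\mathcal H_S$ and $\mathcal H_E$. Let $\hat H_0=\hat H_S\otimes\mathbb I+\mathbb I\otimes\hat H_E$ (closure of the operator on the algebraic tensor product of the domains), let $\hat V=\sum_{j=1}^m\hat S_j\otimes\hat E_j$ be self-adjoint in $\mathcal H$ (that is, $\hat V$ is a self-adjoint operator with $\hat V(s\otimes e)=\sum_j\hat S_js\otimes\hat E_je$ for $s\in\bigcap_j\mathrm{Dom}(\hat S_j)$, $e\in\bigcap_j\mathrm{Dom}(\hat E_j)$), and let $\hat H=\hat H_0+\hat V$ be self-adjoint (that is, $\hat H$ is a self-adjoint operator extending $\hat H_0+\hat V$ on $\mathrm{Dom}(\hat H_0)\cap\mathrm{Dom}(\hat V)$). Put $U(t)=e^{-it\hat H}$. Let $\psi\in\mathcal H_S$ be a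 unit vector, $\hat\rho_S=\langle\psi,\cdot\rangle\psi$, let $\hat\rho_E$ be a density matrix (positive, trace class, trace one) in $\mathcal H_E$, and let $\hat\rho=\hat\rho_S\otimes\hat\rho_E$, $\hat\rho_S^\perp=\mathbb I-\hat\rho_S$. The state of the system at time $t$ is the partial trace $\hat\rho_S(t)=\mathrm{tr}_E\big(U(t)\hat\rho\,U(t)^*\big)$, i.e. the trace class operator with $\mathrm{tr}_S(\hat\rho_S(t)B)=\mathrm{tr}(U(t)\hat\rho\,U(t)^*(B\otimes\mathbb I))$ for all bounded $B$, and its purity is $p_{ur}(t)=\mathrm{tr}_S(\hat\rho_S(t)^2)$. A density matrix is called *mixed* if it is not a projector on a unit vector. An operator product (on its natural domain) that is densely defined and bounded is identified with its bounded extension; "trace class" and "Hilbert–Schmidt" are understood in this sense. **Hypotheses.** 1. There are self-adjoint operators $\hat K_0,\hat K_1$ in $\mathcal H$ with $\hat K_1$ bounded and $\hat K_0$ positive with a bounded, Hilbert–Schmidt inverse, such that $\hat\rho=\hat K_0^{-1}\hat K_1^2\hat K_0^{-1}$; moreover $\hat H^j\hat K_0^{-1}$ and $\hat H_0^j\hat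 K_0^{-1}$ are Hilbert–Schmidt for $j=0,1,2$. 2. $\psi\in\mathrm{Dom}(\hat S_j)$ and $\hat S_{j'}\psi\in\mathrm{Dom}(\hat S_j)$ for all $1\le j,j'\le m$. 3. For all $1\le j,j'\le m$ the operators $\hat E_j\hat\rho_E$, $\hat E_j\hat\rho_E\hat E_{j'}$ and $\hat E_{j'}\hat E_j\hat\rho_E$ are trace class. 4. (Zero means.) $\mathrm{tr}_E(\hat\rho_E\hat E_j)=\mathrm{tr}_E(\hat E_j\hat\rho_E)=0$ for all $1\le j\le m$. **Conclusion.** The function $p_{ur}$ is of class $C^2$ on $\mathbb R$, $\dot p_{ur}(0)=0$, the operator $\hat V\hat\rho\hat V$ is trace class, and $$\ddot p_{ur}(0)=-4\,\mathrm{tr}\big(\hat V\hat\rho\hat V(\hat\rho_S^\perp\otimes\mathbb I)\big)=-4\,\mathrm{tr}_{\mathbb C^m}\big(\Gamma^{(S)}(\Gamma^{(E)})^{\top}\big),$$ where $$\Gamma^{(S)}_{j'j}=\mathrm{tr}_S(\hat\rho_S\hat S_{j'}\hat S_j)-\mathrm{tr}_S(\hat\rho_S\hat S_{j'}\hat\rho_S\hat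 S_j),\qquad \Gamma^{(E)}_{j'j}=\mathrm{tr}_E(\hat\rho_E\hat E_{j'}\hat E_j),$$ these traces being read as $\mathrm{tr}_S(\hat S_{j'}\hat S_j\hat\rho_S)$, $\mathrm{tr}_S(\hat S_{j'}\hat\rho_S\hat S_j\hat\rho_S)$ and $\mathrm{tr}_E(\hat E_{j'}\hat E_j\hat\rho_E)$, respectively. If moreover there are $u,v\in\mathrm{Range}(\hat\rho_S^\perp\otimes\mathbb I)$ with $\langle u,(\hat V\hat\rho\hat V)v\rangle\ne0$, then $\ddot p_{ur}(0)<0$ and there is $t_0>0$ such that $\hat\rho_S(t)$ is a mixed state for all $0<t<t_0$. -/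

import Mathlib

open scoped TensorProduct InnerProductSpace

noncomputable section

namespace OpenQuantum

universe u v

/-! ### Trace class and Hilbert-Schmidt operators -/

section Schatten

variable {H : Type u} [NormedAddCommGroup H] [InnerProductSpace ℂ H] [CompleteSpace H]

variable (H) in
/-- The index set of a fixed orthonormal (Hilbert) basis of `H`. -/
def basisIndex : Set H := (exists_hilbertBasis ℂ H).choose

variable (H) in
/-- A fixed orthonormal (Hilbert) basis of `H`. -/
def stdBasis : HilbertBasis (basisIndex H) ℂ H := (exists_hilbertBasis ℂ H).choose_spec.choose

/-- `T` is Hilbert-Schmidt: `∑ ‖T bᵢ‖² < ∞` for every orthonormal basis `b`. -/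
def IsHilbertSchmidt (T : H →L[ℂ] H) : Prop :=
  ∀ (w : Set H) (b : HilbertBasis w ℂ H), Summable fun i => ‖T (b i)‖ ^ 2

/-- `T` is trace class: it is a product of two Hilbert-Schmidt operators. -/
def IsTraceClass (T : H →L[ℂ] H) : Prop :=
  ∃ A B : H →L[ℂ] H, IsHilbertSchmidt A ∧ IsHilbertSchmidt B ∧ T = A ∘L B

/-- The trace `∑ ⟨bᵢ, T bᵢ⟩`; for trace class `T` the sum converges absolutely and does not depend
on the orthonormal basis `b`. -/
def trace (T : H →L[ℂ] H) : ℂ := ∑' i, ⟪stdBasis H i, T (stdBasis H i)⟫_ℂ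

/-- Density matrices: positive trace class operators of trace one. -/
def IsDensityMatrix (T : H →L[ℂ] H) : Prop :=
  T.IsPositive ∧ IsTraceClass T ∧ trace T = 1

/-- The operator `φ ↦ ⟨ψ, φ⟩ ψ`; for a unit vector `ψ`, the orthogonal projector on `ℂ ψ`. -/
def proj (ψ : H) : H →L[ℂ] H := InnerProductSpace.rankOne ℂ ψ ψ

/-- Pure states: orthogonal projectors on a unit vector. -/
def IsPureState (T : H →L[ℂ] H) : Prop := ∃ ψ : H, ‖ψ‖ = 1 ∧ T = proj ψ

/-- Mixed states: density matrices that are not pure. -/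
def IsMixedState (T : H →L[ℂ] H) : Prop := IsDensityMatrix T ∧ ¬ IsPureState T

/-- The purity `tr (T²)` of a (self-adjoint) state `T`, a real number. -/
def purity (T : H →L[ℂ] H) : ℝ := (trace (T ∘L T)).re

end Schatten

/-! ### Unbounded operators -/

section Unbounded

variable {H : Type u} [NormedAddCommGroup H] [InnerProductSpace ℂ H]

/-- A bounded operator, as an operator with domain the whole space. -/
def bdd (T : H →L[ℂ] H) : H →ₗ.[ℂ] H := T.toLinearMap.toPMap ⊤

/-- The product `A B` of two partially defined operators on its natural domain
`{x ∈ Dom B | B x ∈ Dom A}`. -/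
def comp (A B : H →ₗ.[ℂ] H) : H →ₗ.[ℂ] H where
  domain := (A.domain.comap B.toFun).map B.domain.subtype
  toFun := A.toFun ∘ₗ LinearMap.codRestrict A.domain
    (B.toFun ∘ₗ Submodule.inclusion (Submodule.map_subtype_le B.domain _))
    (by rintro ⟨_, y, hy, rfl⟩; exact hy)

/-- Powers `A ^ k` of a partially defined operator, on their natural domains. -/
def power (A : H →ₗ.[ℂ] H) : ℕ → (H →ₗ.[ℂ] H)
  | 0 => bdd 1
  | k + 1 => comp A (power A k)

/-- `T` is the bounded everywhere defined extension of the densely defined operator `A`. -/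
def IsBoundedExtension (A : H →ₗ.[ℂ] H) (T : H →L[ℂ] H) : Prop :=
  Dense (A.domain : Set H) ∧ ∀ x : A.domain, T x = A x

open Classical in
/-- The bounded extension of a densely defined operator (zero if there is none). -/
def extend (A : H →ₗ.[ℂ] H) : H →L[ℂ] H :=
  if h : ∃ T, IsBoundedExtension A T then h.choose else 0

variable [CompleteSpace H]

/-- A densely defined operator is Hilbert-Schmidt if its bounded extension exists and is so. -/
def IsHilbertSchmidtOp (A : H →ₗ.[ℂ] H) : Prop :=
  ∃ T, IsBoundedExtension A T ∧ IsHilbertSchmidt T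

/-- A densely defined operator is trace class if its bounded extension exists and is so. -/
def IsTraceClassOp (A : H →ₗ.[ℂ] H) : Prop :=
  ∃ T, IsBoundedExtension A T ∧ IsTraceClass T

/-- The trace of (the bounded extension of) a densely defined trace class operator. -/
def traceOp (A : H →ₗ.[ℂ] H) : ℂ := trace (extend A)

/-- `U t = exp (-i t A)`: `U` is the strongly continuous one-parameter unitary group with
generator `-i A`, where `A` is a self-adjoint operator. -/
structure IsPropagator (A : H →ₗ.[ℂ] H) (U : ℝ → H →L[ℂ] H) : Prop where
  unitary : ∀ t, U t ∈ unitary (H →L[ℂ] H)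
  zero : U 0 = 1
  add : ∀ s t, U (s + t) = U s ∘L U t
  continuous : ∀ x, Continuous fun t => U t x
  generator : ∀ x y, (x, y) ∈ A.graph ↔ HasDerivAt (fun t => U t x) (-Complex.I • y) 0

/-- The bounded operator `R` is the inverse of `K`. -/
def IsBoundedInverse (K : H →ₗ.[ℂ] H) (R : H →L[ℂ] H) : Prop :=
  (∀ x, (R x, x) ∈ K.graph) ∧ ∀ x : K.domain, R (K x) = x

end Unbounded

/-! ### Composite systems -/

section Composite

variable (HS : Type u) [NormedAddCommGroup HS] [InnerProductSpace ℂ HS]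
  (HE : Type v) [NormedAddCommGroup HE] [InnerProductSpace ℂ HE]

/-- The Hilbert tensor product of two Hilbert spaces. -/
abbrev HTensor : Type (max u v) := UniformSpace.Completion (HS ⊗[ℂ] HE)

variable {HS HE}

/-- The elementary tensor `a ⊗ b` in the Hilbert tensor product. -/
def tmul (a : HS) (b : HE) : HTensor HS HE := ((a ⊗ₜ[ℂ] b : HS ⊗[ℂ] HE) : HTensor HS HE)

/-- The tensor product `A ⊗ B` of two bounded operators. -/
def opTensor (A : HS →L[ℂ] HS) (B : HE →L[ℂ] HE) : HTensor HS HE →L[ℂ] HTensor HS HE :=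
  (TensorProduct.mapL A B).completion

/-- The free Hamiltonian `A ⊗ 1 + 1 ⊗ B`: the closure of the operator
`a ⊗ b ↦ A a ⊗ b + a ⊗ B b` on the algebraic tensor product of the domains, described through
its graph. -/
def freeHamiltonian (A : HS →ₗ.[ℂ] HS) (B : HE →ₗ.[ℂ] HE) :
    HTensor HS HE →ₗ.[ℂ] HTensor HS HE :=
  (Submodule.span ℂ (Set.range fun p : A.domain × B.domain =>
    ((tmul (p.1 : HS) (p.2 : HE), tmul (A p.1) (p.2 : HE) + tmul (p.1 : HS) (B p.2)) :
      HTensor HS HE × HTensor HS HE))).topologicalClosure.toLinearPMap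

/-- `V` is given by `∑ⱼ Sⱼ ⊗ Eⱼ` on elementary tensors `s ⊗ e` (hence on their span) with
`s ∈ ⋂ⱼ Dom Sⱼ` and `e ∈ ⋂ⱼ Dom Eⱼ`. -/
def IsInteraction {m : ℕ} (S : Fin m → HS →ₗ.[ℂ] HS) (E : Fin m → HE →ₗ.[ℂ] HE)
    (V : HTensor HS HE →ₗ.[ℂ] HTensor HS HE) : Prop :=
  ∀ (s : HS) (e : HE) (hs : ∀ j, s ∈ (S j).domain) (he : ∀ j, e ∈ (E j).domain),
    (tmul s e, ∑ j, tmul (S j ⟨s, hs j⟩) (E j ⟨e, he j⟩)) ∈ V.graph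

variable [CompleteSpace HS]

open Classical in
/-- The partial trace over the environment: the unique trace class operator `tr_E A` on `HS` with
`tr ((tr_E A) B) = tr (A (B ⊗ 1))` for all bounded `B`. -/
def partialTrace (A : HTensor HS HE →L[ℂ] HTensor HS HE) : HS →L[ℂ] HS :=
  if h : ∃ T : HS →L[ℂ] HS, IsTraceClass T ∧
      ∀ B : HS →L[ℂ] HS, trace (T ∘L B) = trace (A ∘L opTensor B 1)
  then h.choose else 0

/-- The reduced state `tr_E (U(t) ρ U(t)*)` of the system at time `t`. -/
def reducedState (U : ℝ → HTensor HS HE →L[ℂ] HTensor HS HE)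
    (ρ : HTensor HS HE →L[ℂ] HTensor HS HE) (t : ℝ) : HS →L[ℂ] HS :=
  partialTrace (U t ∘L ρ ∘L ContinuousLinearMap.adjoint (U t))

end Composite

/-! ### Hypotheses on the states and the covariance matrices -/

section Hypotheses

variable {H : Type u} [NormedAddCommGroup H] [InnerProductSpace ℂ H] [CompleteSpace H] {m : ℕ}

/-- `ρ = K₀⁻¹ K₁² K₀⁻¹` with `K₀` positive self-adjoint, `R = K₀⁻¹` bounded and Hilbert-Schmidt,
and `K₁` bounded self-adjoint. -/
def StateFactorization (ρ : H →L[ℂ] H) (K₀ : H →ₗ.[ℂ] H) (R K₁ : H →L[ℂ] H) : Prop :=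
  IsSelfAdjoint K₀ ∧ (∀ x : K₀.domain, 0 ≤ (⟪(x : H), K₀ x⟫_ℂ).re) ∧
  IsBoundedInverse K₀ R ∧ IsHilbertSchmidt R ∧ IsSelfAdjoint K₁ ∧ ρ = R ∘L K₁ ∘L K₁ ∘L R

/-- `A ^ j R` is Hilbert-Schmidt for all `j ≤ k`. -/
def HamiltonianRegular (k : ℕ) (A : H →ₗ.[ℂ] H) (R : H →L[ℂ] H) : Prop :=
  ∀ j ≤ k, IsHilbertSchmidtOp (comp (power A j) (bdd R))

/-- `ψ` is in the domain of all the `Sⱼ` and of all the products `Sⱼ Sₗ`. -/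
def SystemRegular (S : Fin m → H →ₗ.[ℂ] H) (ψ : H) : Prop :=
  (∀ j, ψ ∈ (S j).domain) ∧ ∀ j l, ψ ∈ (comp (S j) (S l)).domain

/-- The operators `Eⱼ ρ`, `Eⱼ ρ Eₗ` and `Eₗ Eⱼ ρ` are trace class. -/
def EnvironmentRegular (E : Fin m → H →ₗ.[ℂ] H) (ρ : H →L[ℂ] H) : Prop :=
  ∀ j l, IsTraceClassOp (comp (E j) (bdd ρ)) ∧
    IsTraceClassOp (comp (comp (E j) (bdd ρ)) (E l)) ∧
    IsTraceClassOp (comp (E l) (comp (E j) (bdd ρ)))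

/-- `Γ^{(S)}_{jl} = tr (ρ Sⱼ Sₗ) - tr (ρ Sⱼ ρ Sₗ)`, where the leftmost factor `ρ` has been moved
to the right end by cyclicity, so that the operators are defined on the whole space. -/
def covS (S : Fin m → H →ₗ.[ℂ] H) (ρ : H →L[ℂ] H) : Matrix (Fin m) (Fin m) ℂ :=
  Matrix.of fun j l => traceOp (comp (S j) (comp (S l) (bdd ρ))) -
    traceOp (comp (comp (S j) (bdd ρ)) (comp (S l) (bdd ρ)))

/-- `Γ^{(E)}_{jl} = tr (ρ Eⱼ Eₗ)`, with the factor `ρ` moved to the right end by cyclicity. -/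
def covE (E : Fin m → H →ₗ.[ℂ] H) (ρ : H →L[ℂ] H) : Matrix (Fin m) (Fin m) ℂ :=
  Matrix.of fun j l => traceOp (comp (E j) (comp (E l) (bdd ρ)))

end Hypotheses

end OpenQuantum

end

set_option linter.unusedSectionVars false

noncomputable section

namespace OpenQuantum

universe u v

/-! ### Hilbert–Schmidt and trace class operators, independence of the basis -/

section HilbertSchmidt

variable {H K L : Type*} [NormedAddCommGroup H] [InnerProductSpace ℂ H] [CompleteSpace H]
  [NormedAddCommGroup K] [InnerProductSpace ℂ K] [CompleteSpace K]
  [NormedAddCommGroup L] [InnerProductSpace ℂ L] [CompleteSpace L]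
  {ι κ : Type*}

open ContinuousLinearMap (adjoint adjoint_inner_left adjoint_inner_right)

/-! Write `ρ = A A*` with `A = R K₁` Hilbert–Schmidt. As `ρ` is a product with a pure system factor,
`A x = ψ ⊗ a x` with `a a* = ρE` (`product_factorization`). In a Hilbert basis `b` of the total
space, `U(t) A` becomes the square summable family `x(t) = (U(t) A b l)_l`. Since `ham A` and `ham²
A` are Hilbert–Schmidt, `x` is a `C²` curve in `ℓ²` with `x' = -i y`, `y' = -i z`, where `y` and `z`
are the families of `U ham A` and `U ham² A` (`IsPropagator.hasDerivAt_hsVec`). The matrix `M(x, x)`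
of the reduced state (`redMatrix`) is a bounded sesquilinear expression in `x`, and the purity is
its squared norm (`purity_partialTrace`); so the purity is `C²` and the product rule applies.

Take a basis of the system space containing `ψ`, with index `i₀`. At time zero `M(x, x)` is the
matrix unit at `(i₀, i₀)`, so the second derivative is `2‖M'‖² + 2 Re M''(i₀, i₀)`. With `Q = (1 -
|ψ⟩⟨ψ|) ⊗ 1`, symmetry of `ham` gives `M''(i₀, i₀) = 2 M(y, y)(i₀, i₀) - 2‖y‖² = -2‖Q y‖²`. Moreover
`Q ham A = η ⊗ a + W`, where the product term comes from the free Hamiltonian and `W = Q V A`. Zero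
means make `W` orthogonal to every `s ⊗ a`, whence `‖Q y‖² = ‖η‖² + ‖W‖²` and `‖M'‖² = 2‖η‖²`. The
free part cancels and `-4‖W‖²` remains (`norm_redMatrix_product_calculus`).

Both formulas evaluate `‖W‖²`. The one with `V ρ V` is cyclicity of the trace. The one with
covariances needs `tr(Eⱼ Eₖ a a*) = tr((Eⱼ a)* Eₖ a)` for unbounded `Eⱼ`, which rests on
`trace_eq_of_intertwine` and on the fact that `Eⱼ a` is Hilbert–Schmidt (`isHS_root`). Mixedness
follows because the purity starts at 1 with zero slope and negative second derivative, while pure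
states have purity 1. -/

theorem hasSum_norm_inner_sq (b : HilbertBasis ι ℂ H) (x : H) :
    HasSum (fun i => ‖⟪b i, x⟫_ℂ‖ ^ 2) (‖x‖ ^ 2) := by
  have h := Complex.hasSum_re (b.hasSum_inner_mul_inner x x)
  convert! h using 1
  · ext i
    rw [← inner_conj_symm x (b i), mul_comm, Complex.mul_conj, Complex.normSq_eq_norm_sq]
    norm_cast
  · rw [← inner_self_eq_norm_sq (𝕜 := ℂ)]; rfl

/-- Sum `|⟨c j, T (b i)⟩|²` in both orders (Tonelli). Applying this twice allows any change of
basis. -/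
theorem hasSum_norm_adjoint_sq (b : HilbertBasis ι ℂ H) (c : HilbertBasis κ ℂ K) (T : H →L[ℂ] K)
    (h : Summable fun i => ‖T (b i)‖ ^ 2) :
    HasSum (fun j => ‖adjoint T (c j)‖ ^ 2) (∑' i, ‖T (b i)‖ ^ 2) := by
  have hs : Summable fun p : ι × κ => ‖⟪c p.2, T (b p.1)⟫_ℂ‖ ^ 2 := by
    rw [summable_prod_of_nonneg (fun _ => by positivity)]
    exact ⟨fun i => (hasSum_norm_inner_sq c (T (b i))).summable, by
      simpa only [(hasSum_norm_inner_sq c (T (b _))).tsum_eq] using h⟩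
  have h1 := hs.hasSum.prod_fiberwise fun i => hasSum_norm_inner_sq c (T (b i))
  have h2 := ((Equiv.prodComm κ ι).hasSum_iff.mpr hs.hasSum).prod_fiberwise
    (g := fun j => ‖adjoint T (c j)‖ ^ 2) fun j => by
      convert! hasSum_norm_inner_sq b (adjoint T (c j)) using 2 with i
      simp only [Function.comp, Equiv.prodComm_apply, Prod.swap]
      rw [adjoint_inner_right, ← inner_conj_symm, RCLike.norm_conj]
  rwa [h1.tsum_eq]

/-- Hilbert-Schmidt operators between two Hilbert spaces. -/
def IsHS (T : H →L[ℂ] K) : Prop := Summable fun i => ‖T (stdBasis H i)‖ ^ 2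

theorem isHS_of_summable (b : HilbertBasis ι ℂ H) {T : H →L[ℂ] K}
    (h : Summable fun i => ‖T (b i)‖ ^ 2) : IsHS T := by
  have := (hasSum_norm_adjoint_sq _ (stdBasis H) _
    (hasSum_norm_adjoint_sq b (stdBasis K) T h).summable).summable
  simpa [IsHS] using this

theorem IsHS.adjoint {T : H →L[ℂ] K} (h : IsHS T) : IsHS (adjoint T) :=
  (hasSum_norm_adjoint_sq _ (stdBasis K) T h).summable

theorem IsHS.summable {T : H →L[ℂ] K} (h : IsHS T) (b : HilbertBasis ι ℂ H) :
    Summable fun i => ‖T (b i)‖ ^ 2 := by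
  simpa using (hasSum_norm_adjoint_sq (stdBasis K) b _ h.adjoint).summable

theorem isHilbertSchmidt_iff {T : H →L[ℂ] H} : IsHilbertSchmidt T ↔ IsHS T :=
  ⟨fun h => h _ _, fun h _ b => h.summable b⟩

theorem IsHS.comp_left {T : H →L[ℂ] K} (h : IsHS T) (B : K →L[ℂ] L) : IsHS (B ∘L T) := by
  refine Summable.of_nonneg_of_le (fun _ => by positivity) (fun i => ?_)
    (Summable.mul_left (‖B‖ ^ 2) h)
  rw [← mul_pow]
  gcongr
  exact B.le_opNorm _

theorem IsHS.comp_right {T : K →L[ℂ] L} (h : IsHS T) (B : H →L[ℂ] K) : IsHS (T ∘L B) := by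
  have := (h.adjoint.comp_left (ContinuousLinearMap.adjoint B)).adjoint
  rwa [ContinuousLinearMap.adjoint_comp, ContinuousLinearMap.adjoint_adjoint,
    ContinuousLinearMap.adjoint_adjoint] at this

theorem IsHS.add {S T : H →L[ℂ] K} (hS : IsHS S) (hT : IsHS T) : IsHS (S + T) := by
  refine Summable.of_nonneg_of_le (fun _ => by positivity) (fun i => ?_)
    (Summable.mul_left 2 (Summable.add hS hT))
  have := norm_add_le (S (stdBasis H i)) (T (stdBasis H i))
  calc ‖(S + T) (stdBasis H i)‖ ^ 2 ≤ (‖S (stdBasis H i)‖ + ‖T (stdBasis H i)‖) ^ 2 := by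
        gcongr; exact this
    _ ≤ _ := add_sq_le

theorem isHS_zero : IsHS (0 : H →L[ℂ] K) := by simp [IsHS]

theorem IsHS.sum {α : Type*} {s : Finset α} {T : α → H →L[ℂ] K} (h : ∀ j ∈ s, IsHS (T j)) :
    IsHS (∑ j ∈ s, T j) :=
  Finset.sum_induction _ IsHS (fun _ _ => IsHS.add) isHS_zero h

/-- The two iterated sums for the trace of `A B` and of `B A` agree. -/
theorem hasSum_inner_comp (b : HilbertBasis ι ℂ H) (c : HilbertBasis κ ℂ K) {A : K →L[ℂ] H}
    {B : H →L[ℂ] K} (hA : IsHS A) (hB : IsHS B) :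
    HasSum (fun i => ⟪b i, A (B (b i))⟫_ℂ) (∑' j, ⟪c j, B (A (c j))⟫_ℂ) := by
  have hs : Summable fun p : ι × κ => ⟪b p.1, A (c p.2)⟫_ℂ * ⟪c p.2, B (b p.1)⟫_ℂ := by
    have h1 : Summable fun p : ι × κ => ‖⟪b p.1, A (c p.2)⟫_ℂ‖ ^ 2 := by
      refine (Equiv.prodComm κ ι).summable_iff.mp ?_
      rw [summable_prod_of_nonneg (fun _ => by dsimp; positivity)]
      exact ⟨fun i => (hasSum_norm_inner_sq b (A (c i))).summable, by
        simpa [(hasSum_norm_inner_sq b (A (c _))).tsum_eq] using hA.summable c⟩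
    have h2 : Summable fun p : ι × κ => ‖⟪c p.2, B (b p.1)⟫_ℂ‖ ^ 2 := by
      rw [summable_prod_of_nonneg (fun _ => by positivity)]
      exact ⟨fun i => (hasSum_norm_inner_sq c (B (b i))).summable, by
        simpa only [(hasSum_norm_inner_sq c (B (b _))).tsum_eq] using hB.summable b⟩
    refine .of_norm_bounded (h1.add h2) fun p => ?_
    rw [norm_mul]
    nlinarith [sq_nonneg (‖⟪b p.1, A (c p.2)⟫_ℂ‖ - ‖⟪c p.2, B (b p.1)⟫_ℂ‖),
      sq_nonneg ‖⟪b p.1, A (c p.2)⟫_ℂ‖, sq_nonneg ‖⟪c p.2, B (b p.1)⟫_ℂ‖]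
  have h1 := hs.hasSum.prod_fiberwise (g := fun i => ⟪b i, A (B (b i))⟫_ℂ) fun i => by
    have := c.hasSum_inner_mul_inner (ContinuousLinearMap.adjoint A (b i)) (B (b i))
    simpa only [adjoint_inner_left] using this
  have h2 := ((Equiv.prodComm κ ι).hasSum_iff.mpr hs.hasSum).prod_fiberwise
    (g := fun j => ⟪c j, B (A (c j))⟫_ℂ) fun j => by
      have := b.hasSum_inner_mul_inner (ContinuousLinearMap.adjoint B (c j)) (A (c j))
      simpa only [adjoint_inner_left, Function.comp_def, Equiv.prodComm_apply, Prod.swap,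
        mul_comm] using this
  rwa [h2.tsum_eq]

theorem trace_comp_comm {A : K →L[ℂ] H} {B : H →L[ℂ] K} (hA : IsHS A) (hB : IsHS B) :
    trace (A ∘L B) = trace (B ∘L A) :=
  (hasSum_inner_comp (stdBasis H) (stdBasis K) hA hB).tsum_eq

theorem hasSum_trace_comp (b : HilbertBasis ι ℂ H) {A : K →L[ℂ] H} {B : H →L[ℂ] K}
    (hA : IsHS A) (hB : IsHS B) : HasSum (fun i => ⟪b i, A (B (b i))⟫_ℂ) (trace (A ∘L B)) := by
  rw [trace_comp_comm hA hB]
  exact hasSum_inner_comp b (stdBasis K) hA hB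

theorem isTraceClass_comp {A B : H →L[ℂ] H} (hA : IsHS A) (hB : IsHS B) :
    IsTraceClass (A ∘L B) :=
  ⟨A, B, isHilbertSchmidt_iff.mpr hA, isHilbertSchmidt_iff.mpr hB, rfl⟩

theorem IsTraceClass.exists_comp {T : H →L[ℂ] H} (h : IsTraceClass T) :
    ∃ A B : H →L[ℂ] H, IsHS A ∧ IsHS B ∧ T = A ∘L B := by
  obtain ⟨A, B, hA, hB, h⟩ := h
  exact ⟨A, B, isHilbertSchmidt_iff.mp hA, isHilbertSchmidt_iff.mp hB, h⟩

theorem IsTraceClass.hasSum {T : H →L[ℂ] H} (h : IsTraceClass T) (b : HilbertBasis ι ℂ H) :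
    HasSum (fun i => ⟪b i, T (b i)⟫_ℂ) (trace T) := by
  obtain ⟨A, B, hA, hB, rfl⟩ := h.exists_comp
  exact hasSum_trace_comp b hA hB

theorem IsTraceClass.comp_left {T : H →L[ℂ] H} (h : IsTraceClass T) (B : H →L[ℂ] H) :
    IsTraceClass (B ∘L T) := by
  obtain ⟨A, C, hA, hC, rfl⟩ := h.exists_comp
  exact isTraceClass_comp (A := B ∘L A) (hA.comp_left B) hC

theorem IsTraceClass.comp_right {T : H →L[ℂ] H} (h : IsTraceClass T) (B : H →L[ℂ] H) :
    IsTraceClass (T ∘L B) := by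
  obtain ⟨A, C, hA, hC, rfl⟩ := h.exists_comp
  exact isTraceClass_comp (B := C ∘L B) hA (hC.comp_right B)

theorem IsTraceClass.trace_comp_comm {T : H →L[ℂ] H} (h : IsTraceClass T) (B : H →L[ℂ] H) :
    trace (T ∘L B) = trace (B ∘L T) := by
  obtain ⟨A, C, hA, hC, rfl⟩ := h.exists_comp
  rw [ContinuousLinearMap.comp_assoc, OpenQuantum.trace_comp_comm hA (hC.comp_right B),
    ContinuousLinearMap.comp_assoc, OpenQuantum.trace_comp_comm hC (hA.comp_left B),
    ContinuousLinearMap.comp_assoc]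

theorem trace_sub {S T : H →L[ℂ] H} (hS : IsTraceClass S) (hT : IsTraceClass T) :
    trace (S - T) = trace S - trace T := by
  rw [trace, ← ((hS.hasSum (stdBasis H)).sub (hT.hasSum (stdBasis H))).tsum_eq]
  simp

theorem trace_zero : trace (0 : H →L[ℂ] H) = 0 := by simp [trace]

theorem trace_rankOne (x y : H) : trace (InnerProductSpace.rankOne ℂ x y) = ⟪y, x⟫_ℂ := by
  rw [← (stdBasis H).tsum_inner_mul_inner y x, trace]
  simp

/-- The Hilbert-Schmidt inner product as a trace. -/
theorem hasSum_inner_of_isHS (b : HilbertBasis ι ℂ H) {A B : H →L[ℂ] K} (hA : IsHS A)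
    (hB : IsHS B) :
    HasSum (fun i => ⟪A (b i), B (b i)⟫_ℂ) (trace (B ∘L adjoint A)) := by
  rw [trace_comp_comm hB hA.adjoint]
  simpa only [adjoint_inner_right] using hasSum_trace_comp b hA.adjoint hB

/-- The square root is Hilbert–Schmidt, because `‖√T b‖² = ⟨b, T b⟩`. -/
theorem isTraceClass_of_isPositive (b : HilbertBasis ι ℂ H) {T : H →L[ℂ] H} (hT : T.IsPositive)
    (h : Summable fun i => ⟪b i, T (b i)⟫_ℂ) : IsTraceClass T := by
  have hT' : 0 ≤ T := (ContinuousLinearMap.nonneg_iff_isPositive T).mpr hT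
  have hsq : CFC.sqrt T ∘L CFC.sqrt T = T := CFC.sqrt_mul_sqrt_self T hT'
  have hsa : adjoint (CFC.sqrt T) = CFC.sqrt T := (CFC.sqrt_nonneg T).isSelfAdjoint
  have : IsHS (CFC.sqrt T) := by
    refine isHS_of_summable b ?_
    convert! (Complex.hasSum_re h.hasSum).summable using 2 with i
    conv_rhs => rw [← hsq]
    rw [ContinuousLinearMap.comp_apply, ← adjoint_inner_left, hsa,
      ← inner_self_eq_norm_sq (𝕜 := ℂ)]
    rfl
  rw [← hsq]
  exact isTraceClass_comp this this

end HilbertSchmidt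

/-! ### Cyclicity of the trace through an intertwiner, by the mean ergodic theorem -/

section Intertwining

variable {H K : Type*} [NormedAddCommGroup H] [InnerProductSpace ℂ H] [CompleteSpace H]
  [NormedAddCommGroup K] [InnerProductSpace ℂ K] [CompleteSpace K] {ι : Type*}

open Filter Topology
open scoped ComplexOrder
open ContinuousLinearMap (adjoint adjoint_inner_left adjoint_inner_right)

/-- The Cesàro mean of the first `n` powers of `f`. -/
def cesaro (f : H →L[ℂ] H) (n : ℕ) : H →L[ℂ] H := (n : ℂ)⁻¹ • ∑ k ∈ Finset.range n, f ^ k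

theorem norm_cesaro_le {f : H →L[ℂ] H} (hf : ‖f‖ ≤ 1) (n : ℕ) : ‖cesaro f n‖ ≤ 1 := by
  have h : ‖∑ k ∈ Finset.range n, f ^ k‖ ≤ n := by
    refine (norm_sum_le _ _).trans ?_
    refine (Finset.sum_le_sum (g := fun _ => (1 : ℝ)) fun k _ => ?_).trans (by simp)
    clear * - hf
    induction k with
    | zero => exact ContinuousLinearMap.norm_id_le
    | succ k ih =>
      rw [pow_succ]
      exact (norm_mul_le _ _).trans (mul_le_one₀ ih (norm_nonneg _) hf)
  rw [cesaro, norm_smul, norm_inv, Complex.norm_natCast]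
  rcases eq_or_ne n 0 with rfl | hn
  · simp
  · rw [inv_mul_le_one₀ (by positivity)]; exact h

theorem tendsto_cesaro {f : H →L[ℂ] H} (hf : ‖f‖ ≤ 1) :
    ∃ P : H →L[ℂ] H, (∀ x, f (P x) = P x) ∧
      ∀ x, Tendsto (fun n => cesaro f n x) atTop (𝓝 (P x)) := by
  let S := f.eqLocus (1 : H →L[ℂ] H)
  refine ⟨S.starProjection, fun x => ?_, fun x => ?_⟩
  · exact (S.starProjection_apply_mem x)
  · refine (f.tendsto_birkhoffAverage_orthogonalProjection hf x).congr fun n => ?_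
    simp [cesaro, birkhoffAverage, birkhoffSum]

theorem hasSum_trace_comp_comp {A B : H →L[ℂ] H} (hA : IsHS A) (hB : IsHS B) (M : H →L[ℂ] H) :
    HasSum (fun i => ⟪adjoint B (stdBasis H i), M (A (stdBasis H i))⟫_ℂ)
      (trace (M ∘L (A ∘L B))) := by
  rw [← ContinuousLinearMap.comp_assoc, trace_comp_comm (hA.comp_left M) hB]
  refine (hasSum_trace_comp (stdBasis H) hB (hA.comp_left M)).congr_fun fun i => ?_
  exact adjoint_inner_left B _ _

/-- For `G = A B` the trace is a sum of `⟨B* bᵢ, M A bᵢ⟩`, dominated uniformly over contractions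
`M`; strong convergence is therefore enough. -/
theorem tendsto_trace_comp {M : ℕ → H →L[ℂ] H} {P : H →L[ℂ] H} (hM : ∀ n, ‖M n‖ ≤ 1)
    (hP : ∀ x, Tendsto (fun n => M n x) atTop (𝓝 (P x))) {G : H →L[ℂ] H} (hG : IsTraceClass G) :
    Tendsto (fun n => trace (M n ∘L G)) atTop (𝓝 (trace (P ∘L G))) := by
  obtain ⟨A, B, hA, hB, rfl⟩ := hG.exists_comp
  rw [← (hasSum_trace_comp_comp hA hB P).tsum_eq,
    funext fun n => (hasSum_trace_comp_comp hA hB (M n)).tsum_eq.symm]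
  refine tendsto_tsum_of_dominated_convergence
    (bound := fun i => ‖adjoint B (stdBasis H i)‖ ^ 2 + ‖A (stdBasis H i)‖ ^ 2)
    (Summable.add hB.adjoint hA) (fun i => ?_) (Eventually.of_forall fun n i => ?_)
  · exact (tendsto_const_nhds.inner (hP _))
  · refine (norm_inner_le_norm _ _).trans ?_
    have := (M n).le_of_opNorm_le (hM n) (A (stdBasis H i))
    rw [one_mul] at this
    nlinarith [norm_nonneg (adjoint B (stdBasis H i)), norm_nonneg (A (stdBasis H i)),
      sq_nonneg (‖adjoint B (stdBasis H i)‖ - ‖A (stdBasis H i)‖),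
      mul_le_mul_of_nonneg_left this (norm_nonneg (adjoint B (stdBasis H i)))]

/-- By von Neumann's ergodic theorem the means tend strongly to a map `P` into the fixed vectors of
`f`; the limit is `tr(P G) = tr(G P) = 0`. -/
theorem tendsto_trace_cesaro {f : H →L[ℂ] H} (hf : ‖f‖ ≤ 1) {G : H →L[ℂ] H}
    (hG : IsTraceClass G) (h0 : ∀ x, f x = x → G x = 0) :
    Tendsto (fun n => trace (cesaro f n ∘L G)) atTop (𝓝 0) := by
  obtain ⟨P, hfP, hP⟩ := tendsto_cesaro hf
  have hGP : G ∘L P = 0 := ContinuousLinearMap.ext fun x => h0 _ (hfP x)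
  have := tendsto_trace_comp (norm_cesaro_le hf) hP hG
  rwa [← hG.trace_comp_comm, hGP, trace_zero] at this

theorem norm_one_sub_le {T : H →L[ℂ] H} (hT : T.IsPositive) (h : ‖T‖ ≤ 1) : ‖1 - T‖ ≤ 1 := by
  have h0 : 0 ≤ T := (ContinuousLinearMap.nonneg_iff_isPositive T).mpr hT
  have h1 : T ≤ 1 := (CStarAlgebra.norm_le_one_iff_of_nonneg T h0).mp h
  exact (CStarAlgebra.norm_le_one_iff_of_nonneg _ (sub_nonneg.mpr h1)).mpr (by simpa using h0)

/-- Cyclicity of the trace through an intertwiner: if `a* G = C a*` and `G`, `C` vanish on the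
kernels of `a*` and `a`, then `G` and `C` have the same trace. -/
theorem trace_eq_of_intertwine {a : K →L[ℂ] H} (ha : IsHS a) {G : H →L[ℂ] H} {C : K →L[ℂ] K}
    (hG : IsTraceClass G) (hC : IsTraceClass C) (h : adjoint a ∘L G = C ∘L adjoint a)
    (hG0 : ∀ x, adjoint a x = 0 → G x = 0) (hC0 : ∀ y, a y = 0 → C y = 0) :
    trace G = trace C := by
  -- The scaling puts `c a a*` and `c a* a` between 0 and 1, so `f` and `g` below are contractions
  -- whose fixed vectors are the kernels of `a*` and `a`. The added 1 covers `a = 0`.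
  obtain ⟨c, hc0, hc⟩ : ∃ c : ℝ, 0 < c ∧ c * (‖a‖ * ‖a‖) ≤ 1 :=
    ⟨(‖a‖ * ‖a‖ + 1)⁻¹, by positivity, by
      rw [inv_mul_le_one₀ (by positivity)]; linarith⟩
  have hcC : (0 : ℂ) ≤ c := by exact_mod_cast hc0.le
  set f : H →L[ℂ] H := 1 - (c : ℂ) • (a ∘L adjoint a) with hf
  set g : K →L[ℂ] K := 1 - (c : ℂ) • (adjoint a ∘L a) with hg
  have hf1 : ‖f‖ ≤ 1 := by
    refine norm_one_sub_le ((ContinuousLinearMap.isPositive_self_comp_adjoint a).smul_of_nonneg hcC)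
      ?_
    rw [norm_smul, Complex.norm_real, Real.norm_of_nonneg hc0.le]
    have := ContinuousLinearMap.opNorm_comp_le a (adjoint a)
    rw [LinearIsometryEquiv.norm_map] at this
    nlinarith
  have hg1 : ‖g‖ ≤ 1 := by
    refine norm_one_sub_le ((ContinuousLinearMap.isPositive_adjoint_comp_self a).smul_of_nonneg hcC)
      ?_
    rw [norm_smul, Complex.norm_real, Real.norm_of_nonneg hc0.le]
    have := ContinuousLinearMap.opNorm_comp_le (adjoint a) a
    rw [LinearIsometryEquiv.norm_map] at this
    nlinarith
  have hfix {x : H} (hx : f x = x) : G x = 0 := by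
    refine hG0 x ?_
    have h1 : a (adjoint a x) = 0 := by
      have : (c : ℂ) • a (adjoint a x) = 0 := by simpa [hf] using hx
      exact (smul_eq_zero.mp this).resolve_left (by exact_mod_cast hc0.ne')
    rw [← norm_eq_zero, ← sq_eq_zero_iff, ← inner_self_eq_norm_sq (𝕜 := ℂ), adjoint_inner_right,
      h1]
    simp
  have hfix' {x : K} (hx : g x = x) : C x = 0 := by
    refine hC0 x ?_
    have h1 : adjoint a (a x) = 0 := by
      have : (c : ℂ) • adjoint a (a x) = 0 := by simpa [hg] using hx
      exact (smul_eq_zero.mp this).resolve_left (by exact_mod_cast hc0.ne')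
    rw [← norm_eq_zero, ← sq_eq_zero_iff, ← inner_self_eq_norm_sq (𝕜 := ℂ), ← adjoint_inner_right,
      h1]
    simp
  -- `1 - f ^ k` is divisible by `a*` on the right, and the same quotient `Y` gives `1 - g ^ k` on
  -- the other side. The recursion `f Y + c a` comes from `1 - f ^ (k+1) = f (1 - f ^ k) + (1 - f)`.
  have hpow (k : ℕ) : ∃ Y : K →L[ℂ] H, IsHS Y ∧ Y ∘L adjoint a = 1 - f ^ k ∧
      adjoint a ∘L Y = 1 - g ^ k := by
    induction k with
    | zero => exact ⟨0, isHS_zero, by simp, by simp⟩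
    | succ k ih =>
      obtain ⟨Y, hY, h1, h2⟩ := ih
      refine ⟨f ∘L Y + ((c : ℂ) • 1) ∘L a, (hY.comp_left f).add (ha.comp_left _), ?_, ?_⟩
      · rw [ContinuousLinearMap.add_comp, ContinuousLinearMap.comp_assoc, h1, pow_succ']
        rw [ContinuousLinearMap.mul_def]
        generalize f ^ k = F
        ext x
        simp only [hf, add_apply, ContinuousLinearMap.comp_apply,
          sub_apply, one_apply_eq_self,
          smul_apply, map_sub]
        module
      · have h3 : adjoint a ∘L f = g ∘L adjoint a := by ext x; simp [hf, hg]
        rw [ContinuousLinearMap.comp_add, ← ContinuousLinearMap.comp_assoc, h3,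
          ContinuousLinearMap.comp_assoc, h2, pow_succ']
        rw [ContinuousLinearMap.mul_def]
        generalize g ^ k = F
        ext x
        simp only [hg, add_apply, ContinuousLinearMap.comp_apply,
          sub_apply, one_apply_eq_self, map_smul,
          smul_apply, map_sub]
        module
  have hces (n : ℕ) (hn : n ≠ 0) : ∃ Y : K →L[ℂ] H, IsHS Y ∧ Y ∘L adjoint a = 1 - cesaro f n ∧
      adjoint a ∘L Y = 1 - cesaro g n := by
    choose Y hY h1 h2 using hpow
    have hn' : (n : ℂ) ≠ 0 := by exact_mod_cast hn
    refine ⟨((n : ℂ)⁻¹ • 1) ∘L ∑ k ∈ Finset.range n, Y k,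
      (IsHS.sum fun k _ => hY k).comp_left _, ?_, ?_⟩
    · ext x
      have (k : ℕ) : Y k (adjoint a x) = x - (f ^ k) x := by
        simpa using congr($(h1 k) x)
      simp [cesaro, this, smul_sub, smul_smul, hn',
        ← Nat.cast_smul_eq_nsmul ℂ]
    · ext x
      have (k : ℕ) : adjoint a (Y k x) = x - (g ^ k) x := by
        simpa using congr($(h2 k) x)
      simp [cesaro, this, smul_sub, smul_smul, hn',
        ← Nat.cast_smul_eq_nsmul ℂ]
  have hlim := (tendsto_trace_cesaro hf1 hG fun x => hfix).sub
    (tendsto_trace_cesaro hg1 hC fun x => hfix')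
  -- Both traces lose the same amount under averaging: `tr(Y a* G) = tr(Y C a*) = tr(C a* Y)`, where
  -- each swap involves Hilbert–Schmidt factors. The mean with `n = 0` is zero and must be excluded.
  have hconst : ∀ᶠ n in atTop, trace (cesaro f n ∘L G) - trace (cesaro g n ∘L C) =
      trace G - trace C := by
    filter_upwards [eventually_ne_atTop 0] with n hn
    obtain ⟨Y, hY, h1, h2⟩ := hces n hn
    have e1 : trace G - trace (cesaro f n ∘L G) = trace (Y ∘L C ∘L adjoint a) := by
      rw [← h, ← ContinuousLinearMap.comp_assoc, h1, ← trace_sub hG (hG.comp_left _)]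
      rfl
    have e2 : trace C - trace (cesaro g n ∘L C) = trace (Y ∘L C ∘L adjoint a) := by
      rw [trace_comp_comm hY (ha.adjoint.comp_left C), ContinuousLinearMap.comp_assoc, h2,
        hC.trace_comp_comm, ← trace_sub hC (hC.comp_left _)]
      rfl
    linear_combination e2 - e1
  have := tendsto_nhds_unique (hlim.congr' hconst) tendsto_const_nhds
  rw [sub_zero] at this
  exact sub_eq_zero.mp this.symm

end Intertwining

/-! ### Slices and bases of the Hilbert tensor product -/

section Tensor

variable {HS HE : Type*} [NormedAddCommGroup HS] [InnerProductSpace ℂ HS] [CompleteSpace HS]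
  [NormedAddCommGroup HE] [InnerProductSpace ℂ HE] [CompleteSpace HE] {ι κ : Type*}

open ContinuousLinearMap (adjoint adjoint_inner_left adjoint_inner_right)
open InnerProductSpace (rankOne)

theorem inner_tmul (a c : HS) (b d : HE) :
    ⟪tmul a b, tmul c d⟫_ℂ = ⟪a, c⟫_ℂ * ⟪b, d⟫_ℂ := by
  simp [tmul, UniformSpace.Completion.inner_coe]

variable (HE) in
/-- `e ↦ s ⊗ e`. -/
def tmulL (s : HS) : HE →L[ℂ] HTensor HS HE :=
  UniformSpace.Completion.toComplL ∘L TensorProduct.mkL ℂ HS HE s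

variable (HS) in
/-- `s ↦ s ⊗ e`. -/
def tmulR (e : HE) : HS →L[ℂ] HTensor HS HE :=
  UniformSpace.Completion.toComplL ∘L (TensorProduct.mkL ℂ HS HE).flip e

@[simp] theorem tmulL_apply (s : HS) (e : HE) : tmulL HE s e = tmul s e := rfl

@[simp] theorem tmulR_apply (s : HS) (e : HE) : tmulR HS e s = tmul s e := rfl

theorem adjoint_tmulL_tmul (s s' : HS) (e : HE) :
    adjoint (tmulL HE s) (tmul s' e) = ⟪s, s'⟫_ℂ • e := by
  refine ext_inner_left ℂ fun x => ?_
  rw [adjoint_inner_right, tmulL_apply, inner_tmul, inner_smul_right]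

@[simp] theorem opTensor_tmul (A : HS →L[ℂ] HS) (B : HE →L[ℂ] HE) (s : HS) (e : HE) :
    opTensor A B (tmul s e) = tmul (A s) (B e) := by
  simp [opTensor, tmul]

theorem topologicalClosure_span_tmul :
    (Submodule.span ℂ {x : HTensor HS HE | ∃ s e, x = tmul s e}).topologicalClosure = ⊤ := by
  rw [Submodule.eq_top_iff']
  intro x
  induction x using UniformSpace.Completion.induction_on with
  | hp => exact Submodule.isClosed_topologicalClosure _
  | ih x =>
    refine Submodule.le_topologicalClosure _ ?_
    induction x using TensorProduct.induction_on with
    | zero => exact zero_mem _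
    | tmul s e => exact Submodule.subset_span ⟨s, e, rfl⟩
    | add x y hx hy =>
      rw [UniformSpace.Completion.coe_add]
      exact add_mem hx hy

theorem clm_ext_tmul {F : Type*} [NormedAddCommGroup F] [NormedSpace ℂ F]
    {A B : HTensor HS HE →L[ℂ] F} (h : ∀ s e, A (tmul s e) = B (tmul s e)) : A = B := by
  refine ContinuousLinearMap.ext_on (s := {x : HTensor HS HE | ∃ s e, x = tmul s e}) ?_ ?_
  · rw [Submodule.dense_iff_topologicalClosure_eq_top]
    exact topologicalClosure_span_tmul
  · rintro _ ⟨s, e, rfl⟩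
    exact h s e

theorem eq_zero_of_inner_tmul {x : HTensor HS HE} (h : ∀ s e, ⟪x, tmul s e⟫_ℂ = 0) : x = 0 := by
  have : innerSL ℂ x = 0 := clm_ext_tmul fun s e => by simpa using h s e
  exact inner_self_eq_zero.mp congr($this x)

/-- Reduces the projector on the system state to the slice map `adjoint (tmulL HE v)`, a partial
inner product with `v`. -/
theorem opTensor_rankOne (u v : HS) (B : HE →L[ℂ] HE) :
    opTensor (rankOne ℂ u v) B = tmulL HE u ∘L B ∘L adjoint (tmulL HE v) := by
  refine clm_ext_tmul fun s e => ?_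
  rw [opTensor_tmul]
  simp only [ContinuousLinearMap.comp_apply, adjoint_tmulL_tmul, map_smul, tmulL_apply,
    InnerProductSpace.rankOne_apply]
  rw [← tmulR_apply, map_smul, tmulR_apply]

theorem opTensor_one : opTensor (1 : HS →L[ℂ] HS) (1 : HE →L[ℂ] HE) = 1 :=
  clm_ext_tmul fun s e => by simp

theorem opTensor_sub (A A' : HS →L[ℂ] HS) (B : HE →L[ℂ] HE) :
    opTensor (A - A') B = opTensor A B - opTensor A' B :=
  clm_ext_tmul fun s e => by
    simp only [opTensor_tmul, sub_apply]
    rw [← tmulR_apply, map_sub, tmulR_apply, tmulR_apply]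

theorem eq_zero_of_inner_basis {H : Type*} [NormedAddCommGroup H] [InnerProductSpace ℂ H]
    [CompleteSpace H] (b : HilbertBasis ι ℂ H) {x : H} (h : ∀ i, ⟪b i, x⟫_ℂ = 0) : x = 0 := by
  have := hasSum_norm_inner_sq b x
  simp only [h, norm_zero, ne_eq, OfNat.ofNat_ne_zero, not_false_eq_true, zero_pow] at this
  simpa using (this.unique hasSum_zero)

/-- The Hilbert basis `b i ⊗ c k` of the Hilbert tensor product. -/
def tensorBasis (b : HilbertBasis ι ℂ HS) (c : HilbertBasis κ ℂ HE) :
    HilbertBasis (ι × κ) ℂ (HTensor HS HE) :=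
  HilbertBasis.mkOfOrthogonalEqBot (v := fun p : ι × κ => tmul (b p.1) (c p.2))
    (by
      classical
      rw [orthonormal_iff_ite]
      rintro ⟨i, k⟩ ⟨j, l⟩
      rw [inner_tmul, orthonormal_iff_ite.mp b.orthonormal, orthonormal_iff_ite.mp c.orthonormal]
      simp only [Prod.mk.injEq, ite_and]
      split_ifs <;> simp)
    (by
      rw [Submodule.eq_bot_iff]
      intro x hx
      have hx' (i k) : ⟪tmul (b i) (c k), x⟫_ℂ = 0 :=
        (Submodule.mem_orthogonal _ _).mp hx _ (Submodule.subset_span ⟨(i, k), rfl⟩)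
      have h1 (i) : adjoint (tmulL HE (b i)) x = 0 :=
        eq_zero_of_inner_basis c fun k => by rw [adjoint_inner_right]; exact hx' i k
      have h2 (e : HE) : adjoint (tmulR HS e) x = 0 :=
        eq_zero_of_inner_basis b fun i => by
          rw [adjoint_inner_right, tmulR_apply, ← tmulL_apply, ← adjoint_inner_right, h1,
            inner_zero_right]
      refine eq_zero_of_inner_tmul fun s e => ?_
      rw [← tmulR_apply, ← adjoint_inner_left, h2, inner_zero_left])

@[simp] theorem tensorBasis_apply (b : HilbertBasis ι ℂ HS) (c : HilbertBasis κ ℂ HE) (p : ι × κ) :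
    tensorBasis b c p = tmul (b p.1) (c p.2) := by
  simp [tensorBasis]

theorem hasSum_norm_adjoint_tmulL_sq (b : HilbertBasis ι ℂ HS) (x : HTensor HS HE) :
    HasSum (fun i => ‖adjoint (tmulL HE (b i)) x‖ ^ 2) (‖x‖ ^ 2) := by
  refine (hasSum_norm_inner_sq (tensorBasis b (stdBasis HE)) x).prod_fiberwise fun i => ?_
  convert! hasSum_norm_inner_sq (stdBasis HE) (adjoint (tmulL HE (b i)) x) using 4 with k
  rw [adjoint_inner_right, tensorBasis_apply, tmulL_apply]

end Tensor

/-! ### Existence and matrix elements of the partial trace -/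

section PartialTrace

variable {HS HE : Type*} [NormedAddCommGroup HS] [InnerProductSpace ℂ HS] [CompleteSpace HS]
  [NormedAddCommGroup HE] [InnerProductSpace ℂ HE] [CompleteSpace HE] {ι κ : Type*}

open ContinuousLinearMap (adjoint adjoint_inner_left adjoint_inner_right)
open InnerProductSpace (rankOne)

theorem sq_opNorm_le_tsum {H K : Type*} [NormedAddCommGroup H] [InnerProductSpace ℂ H]
    [CompleteSpace H] [NormedAddCommGroup K] [InnerProductSpace ℂ K] [CompleteSpace K]
    (b : HilbertBasis ι ℂ H) {T : H →L[ℂ] K} (hT : IsHS T) :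
    ‖T‖ ^ 2 ≤ ∑' i, ‖T (b i)‖ ^ 2 := by
  have hnn : 0 ≤ ∑' i, ‖T (b i)‖ ^ 2 := tsum_nonneg fun _ => by positivity
  rw [← Real.le_sqrt (norm_nonneg _) hnn]
  refine T.opNorm_le_bound (Real.sqrt_nonneg _) fun x => ?_
  refine le_of_sq_le_sq ?_ (by positivity)
  rw [mul_pow, Real.sq_sqrt hnn]
  refine hasSum_le (fun j => ?_) (hasSum_norm_inner_sq (stdBasis K) (T x))
    ((hasSum_norm_adjoint_sq b (stdBasis K) T (hT.summable b)).mul_right (‖x‖ ^ 2))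
  rw [← adjoint_inner_left, ← mul_pow]
  gcongr
  exact norm_inner_le_norm _ _

theorem isPositive_of_hasSum_inner_self {H K : Type*} [NormedAddCommGroup H]
    [InnerProductSpace ℂ H] [CompleteSpace H] [NormedAddCommGroup K] [InnerProductSpace ℂ K]
    {T : H →L[ℂ] H} {y : H → ι → K}
    (h : ∀ x, HasSum (fun i => ⟪y x i, y x i⟫_ℂ) ⟪x, T x⟫_ℂ) : T.IsPositive := by
  rw [ContinuousLinearMap.isPositive_iff_complex]
  intro x
  have h1 : HasSum (fun i => ‖y x i‖ ^ 2) (⟪x, T x⟫_ℂ).re := by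
    convert! Complex.hasSum_re (h x) using 2 with i
    rw [← inner_self_eq_norm_sq (𝕜 := ℂ)]
    rfl
  have h2 : ((⟪x, T x⟫_ℂ).re : ℂ) = ⟪x, T x⟫_ℂ := by
    refine ((Complex.hasSum_ofReal.mpr h1).congr_fun fun i => ?_).unique (h x)
    rw [inner_self_eq_norm_sq_to_K]
    norm_cast
  have h3 : ⟪T x, x⟫_ℂ = ⟪x, T x⟫_ℂ := by
    rw [← inner_conj_symm, ← h2, Complex.conj_ofReal]
  rw [h3]
  exact ⟨h2, h1.nonneg fun _ => by positivity⟩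

/-- A positive trace class operator with the defining property of the partial trace exists. -/
theorem exists_partialTrace {X : HTensor HS HE →L[ℂ] HTensor HS HE} (hX : IsHS X) :
    ∃ T : HS →L[ℂ] HS, IsTraceClass T ∧ ∀ B : HS →L[ℂ] HS,
      trace (T ∘L B) = trace ((X ∘L adjoint X) ∘L opTensor B 1) := by
  have hXX := isTraceClass_comp hX hX.adjoint
  let b := stdBasis HS
  let c := stdBasis HE
  -- The partial trace is built as `∑ₖ Yₖ* Yₖ`, the environment-diagonal part of `X X*`. It
  -- converges in operator norm, since `‖Yₖ‖²` is at most the squared Hilbert–Schmidt norm and these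
  -- sum to that of `X*`.
  let Y (k) : HS →L[ℂ] HTensor HS HE := adjoint X ∘L tmulR HS (c k)
  have hprod : Summable fun p : basisIndex HS × basisIndex HE =>
      ‖adjoint X (tmul (b p.1) (c p.2))‖ ^ 2 := by
    simpa using hX.adjoint.summable (tensorBasis b c)
  have hY (k) : IsHS (Y k) :=
    isHS_of_summable b (hprod.comp_injective (i := fun i => (i, k)) fun i j h => by simpa using h)
  have hsum : Summable fun k => adjoint (Y k) ∘L Y k := by
    have h1 : Summable fun k => ∑' i, ‖Y k (b i)‖ ^ 2 :=
      ((Equiv.prodComm _ _).summable_iff.mpr hprod).prod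
    refine .of_norm_bounded h1 fun k => ?_
    refine (ContinuousLinearMap.opNorm_comp_le _ _).trans ?_
    rw [LinearIsometryEquiv.norm_map, ← sq]
    exact sq_opNorm_le_tsum b (hY k)
  obtain ⟨T, hT⟩ := hsum
  have hin (x y : HS) : HasSum (fun k => ⟪adjoint X (tmul x (c k)), adjoint X (tmul y (c k))⟫_ℂ)
      ⟪x, T y⟫_ℂ := by
    have h1 : HasSum (fun k => (adjoint (Y k) ∘L Y k) y) (T y) :=
      hT.mapL (ContinuousLinearMap.apply ℂ HS y)
    convert! h1.mapL (innerSL ℂ x) using 2 with k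
    exact (adjoint_inner_right (Y k) x (Y k y)).symm
  have hB (B : HS →L[ℂ] HS) : HasSum (fun i => ⟪b i, T (B (b i))⟫_ℂ)
      (trace ((X ∘L adjoint X) ∘L opTensor B 1)) := by
    refine ((hXX.comp_right (opTensor B 1)).hasSum (tensorBasis b c)).prod_fiberwise fun i => ?_
    convert! hin (b i) (B (b i)) using 2 with k
    simp [adjoint_inner_left]
  have hpos : T.IsPositive :=
    isPositive_of_hasSum_inner_self fun x => hin x x
  have hTr : IsTraceClass T := isTraceClass_of_isPositive b hpos (hB 1).summable
  exact ⟨T, hTr, fun B => ((hTr.comp_right B).hasSum b).unique (hB B)⟩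

theorem partialTrace_spec {X : HTensor HS HE →L[ℂ] HTensor HS HE} (hX : IsHS X) :
    IsTraceClass (partialTrace (X ∘L adjoint X)) ∧ ∀ B : HS →L[ℂ] HS,
      trace (partialTrace (X ∘L adjoint X) ∘L B) =
        trace ((X ∘L adjoint X) ∘L opTensor B 1) := by
  have h := exists_partialTrace hX
  rw [partialTrace, dif_pos h]
  exact h.choose_spec

/-- Test the defining property against `B = |u⟩⟨v|`, then move `X` cyclically to expand over `b`. -/
theorem hasSum_inner_partialTrace {X : HTensor HS HE →L[ℂ] HTensor HS HE} (hX : IsHS X)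
    (b : HilbertBasis ι ℂ (HTensor HS HE)) (u v : HS) :
    HasSum (fun l => ⟪adjoint (tmulL HE u) (X (b l)), adjoint (tmulL HE v) (X (b l))⟫_ℂ)
      ⟪v, partialTrace (X ∘L adjoint X) u⟫_ℂ := by
  have h1 : trace (partialTrace (X ∘L adjoint X) ∘L rankOne ℂ u v) =
      ⟪v, partialTrace (X ∘L adjoint X) u⟫_ℂ := by
    rw [← trace_rankOne]
    congr 1
    ext x
    simp
  rw [← h1, (partialTrace_spec hX).2, opTensor_rankOne, ContinuousLinearMap.comp_assoc,
    trace_comp_comm hX (hX.adjoint.comp_right _)]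
  refine (hasSum_trace_comp b (hX.adjoint.comp_right _) hX).congr_fun fun l => ?_
  exact (adjoint_inner_left (tmulL HE u) _ _).trans (adjoint_inner_right X _ _).symm

theorem isPositive_partialTrace {X : HTensor HS HE →L[ℂ] HTensor HS HE} (hX : IsHS X) :
    (partialTrace (X ∘L adjoint X)).IsPositive :=
  isPositive_of_hasSum_inner_self fun x =>
    hasSum_inner_partialTrace hX (stdBasis (HTensor HS HE)) x x

end PartialTrace

/-! ### Hilbert–Schmidt operators as square summable families, and their evolution -/

section SquareSummable

variable {ι : Type*} {H K L : Type*} [NormedAddCommGroup H] [InnerProductSpace ℂ H]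
  [CompleteSpace H] [NormedAddCommGroup K] [InnerProductSpace ℂ K] [CompleteSpace K]
  [NormedAddCommGroup L] [InnerProductSpace ℂ L] [CompleteSpace L]

open Filter Topology
open ContinuousLinearMap (adjoint adjoint_inner_left adjoint_inner_right)

theorem memℓp_two_iff {f : ι → K} : Memℓp f 2 ↔ Summable fun i => ‖f i‖ ^ 2 := by
  rw [memℓp_gen_iff (by norm_num)]
  norm_num

theorem lp_hasSum_norm_sq (f : lp (fun _ : ι => K) 2) :
    HasSum (fun i => ‖f i‖ ^ 2) (‖f‖ ^ 2) := by
  have := lp.hasSum_norm (by norm_num) f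
  norm_num at this
  exact this

/-- The family of the values of a Hilbert-Schmidt operator on a Hilbert basis. -/
def hsVec (b : HilbertBasis ι ℂ H) (T : H →L[ℂ] K) (hT : IsHS T) : lp (fun _ : ι => K) 2 :=
  ⟨fun i => T (b i), memℓp_two_iff.mpr (hT.summable b)⟩

@[simp] theorem hsVec_apply (b : HilbertBasis ι ℂ H) (T : H →L[ℂ] K) (hT : IsHS T) (i : ι) :
    hsVec b T hT i = T (b i) := rfl

/-- A bounded operator acting on square summable families. -/
def lpMap (ι : Type*) (T : K →L[ℂ] L) : lp (fun _ : ι => K) 2 →ₗ[ℂ] lp (fun _ : ι => L) 2 where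
  toFun f := ⟨fun i => T (f i), memℓp_two_iff.mpr <| by
    refine Summable.of_nonneg_of_le (fun _ => by positivity) (fun i => ?_)
      ((lp_hasSum_norm_sq f).summable.mul_left (‖T‖ ^ 2))
    rw [← mul_pow]
    gcongr
    exact T.le_opNorm _⟩
  map_add' f g := by ext i; exact map_add T (f i) (g i)
  map_smul' c f := by ext i; simp

/-- Evaluation of a square summable family at an index. -/
def lpEval (i : ι) : lp (fun _ : ι => K) 2 →L[ℝ] K :=
  LinearMap.mkContinuous
    { toFun := fun f => f i
      map_add' := fun _ _ => rfl
      map_smul' := fun _ _ => rfl } 1 fun f => by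
    rw [one_mul]
    exact lp.norm_apply_le_norm (by norm_num) f i

/-- `F` and the integral of `F'` have the same derivative in each coordinate, hence differ by a
constant; continuity of `F'` in `ℓ²` makes the integral differentiable there. -/
theorem hasDerivAt_lp {F F' : ℝ → lp (fun _ : ι => K) 2} (hF' : Continuous F')
    (h : ∀ i t, HasDerivAt (fun t => F t i) (F' t i) t) (t : ℝ) : HasDerivAt F (F' t) t := by
  set G : ℝ → lp (fun _ : ι => K) 2 := fun t => ∫ s in (0 : ℝ)..t, F' s with hG
  have hGd (t : ℝ) : HasDerivAt G (F' t) t := (hF'.integral_hasStrictDerivAt 0 t).hasDerivAt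
  have hGi (i : ι) (t : ℝ) : HasDerivAt (fun t => G t i) (F' t i) t := by
    have := (lpEval (K := K) i).hasFDerivAt.comp_hasDerivAt t (hGd t)
    exact this
  have hFG : F = fun t => G t + F 0 := by
    ext t i
    have h1 (t : ℝ) : HasDerivAt (fun t => F t i - G t i) 0 t := by
      have := (h i t).sub (hGi i t)
      rw [sub_self] at this
      exact this
    have h2 := is_const_of_deriv_eq_zero (fun t => (h1 t).differentiableAt)
      (fun t => (h1 t).deriv) t 0
    simp only [hG, intervalIntegral.integral_same, lp.coeFn_zero, Pi.zero_apply, sub_zero] at h2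
    rw [lp.coeFn_add, Pi.add_apply, ← h2]
    simp [hG]
  rw [hFG]
  exact (hGd t).add_const _

variable {ham : H →ₗ.[ℂ] H} {U : ℝ → H →L[ℂ] H}

theorem IsPropagator.norm_map (hU : IsPropagator ham U) (t : ℝ) (x : H) : ‖U t x‖ = ‖x‖ :=
  ContinuousLinearMap.norm_map_of_mem_unitary (hU.unitary t) x

theorem IsPropagator.hasDerivAt (hU : IsPropagator ham U) {x y : H} (h : (x, y) ∈ ham.graph)
    (t : ℝ) : HasDerivAt (fun t => U t x) (-Complex.I • U t y) t := by
  have h0 := (hU.generator x y).mp h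
  have h1 : HasDerivAt (fun s => U t (U (s - t) x)) (U t (-Complex.I • y)) t := by
    have h2 : HasDerivAt (fun s => U (s - t) x) (-Complex.I • y) t :=
      HasDerivAt.comp_sub_const t t (by rwa [sub_self])
    exact ((U t).restrictScalars ℝ).hasFDerivAt.comp_hasDerivAt t h2
  rw [map_smul] at h1
  convert! h1 using 1
  ext s
  rw [← ContinuousLinearMap.comp_apply, ← hU.add, add_sub_cancel]

/-- Strong continuity becomes Hilbert–Schmidt continuity by dominated convergence: unitarity bounds
each term by `(2‖T bᵢ‖)²`. -/
theorem IsPropagator.continuous_hsVec (hU : IsPropagator ham U) (b : HilbertBasis ι ℂ K)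
    {T : K →L[ℂ] H} (hT : IsHS T) :
    Continuous fun t => hsVec b (U t ∘L T) (hT.comp_left (U t)) := by
  rw [continuous_iff_continuousAt]
  intro t
  rw [ContinuousAt, tendsto_iff_norm_sub_tendsto_zero]
  have h1 : Tendsto (fun s => ∑' i, ‖U s (T (b i)) - U t (T (b i))‖ ^ 2) (𝓝 t) (𝓝 0) := by
    have := tendsto_tsum_of_dominated_convergence (𝓕 := 𝓝 t)
      (f := fun s i => ‖U s (T (b i)) - U t (T (b i))‖ ^ 2) (g := fun _ => (0 : ℝ))
      (bound := fun i => (2 ^ 2) * ‖T (b i)‖ ^ 2) ((hT.summable b).mul_left _) (fun i => ?_)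
      (Eventually.of_forall fun s i => ?_)
    · simpa using this
    · have := (((hU.continuous (T (b i))).tendsto t).sub_const (U t (T (b i)))).norm.pow 2
      simpa using this
    · rw [Real.norm_of_nonneg (by positivity), ← mul_pow]
      gcongr
      refine (norm_sub_le _ _).trans ?_
      rw [hU.norm_map, hU.norm_map, two_mul]
  have h2 := (Real.continuous_sqrt.tendsto 0).comp h1
  rw [Real.sqrt_zero] at h2
  refine h2.congr fun s => ?_
  rw [Function.comp_apply, Real.sqrt_eq_iff_eq_sq (tsum_nonneg fun _ => by positivity)
    (norm_nonneg _), ← (lp_hasSum_norm_sq _).tsum_eq]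
  rfl

theorem IsPropagator.hasDerivAt_hsVec (hU : IsPropagator ham U) (b : HilbertBasis ι ℂ K)
    {T T' : K →L[ℂ] H} (hT : IsHS T) (hT' : IsHS T') (h : ∀ x, (T x, T' x) ∈ ham.graph) (t : ℝ) :
    HasDerivAt (fun t => hsVec b (U t ∘L T) (hT.comp_left (U t)))
      (-Complex.I • hsVec b (U t ∘L T') (hT'.comp_left (U t))) t := by
  refine hasDerivAt_lp (F' := fun t => -Complex.I • hsVec b (U t ∘L T') (hT'.comp_left (U t)))
    ?_ (fun i t => ?_) t
  · exact (hU.continuous_hsVec b hT').const_smul (-Complex.I)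
  · exact hU.hasDerivAt (h (b i)) t

end SquareSummable

/-! ### The reduced state as a bounded sesquilinear expression -/

section Bilinear

open ContinuousLinearMap (adjoint adjoint_inner_left adjoint_inner_right)

variable {ι κ : Type*} {HS HE : Type*} [NormedAddCommGroup HS] [InnerProductSpace ℂ HS]
  [CompleteSpace HS] [NormedAddCommGroup HE] [InnerProductSpace ℂ HE] [CompleteSpace HE]

theorem hasSum_norm_lpMap_adjoint_tmulL_sq (e : HilbertBasis κ ℂ HS)
    (x : lp (fun _ : ι => HTensor HS HE) 2) :
    HasSum (fun i => ‖lpMap ι (adjoint (tmulL HE (e i))) x‖ ^ 2) (‖x‖ ^ 2) := by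
  have hs : Summable fun p : ι × κ => ‖adjoint (tmulL HE (e p.2)) (x p.1)‖ ^ 2 := by
    rw [summable_prod_of_nonneg (fun _ => by positivity)]
    refine ⟨fun l => (hasSum_norm_adjoint_tmulL_sq e (x l)).summable, ?_⟩
    simpa only [(hasSum_norm_adjoint_tmulL_sq e (x _)).tsum_eq] using
      (lp_hasSum_norm_sq x).summable
  have h1 := hs.hasSum.prod_fiberwise fun l => hasSum_norm_adjoint_tmulL_sq e (x l)
  rw [(lp_hasSum_norm_sq x).unique h1]
  exact ((Equiv.prodComm κ ι).hasSum_iff.mpr hs.hasSum).prod_fiberwise fun i =>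
    lp_hasSum_norm_sq (lpMap ι (adjoint (tmulL HE (e i))) x)

/-- The matrix, in the Hilbert basis `e`, of the partial trace of `X Y*`, where the Hilbert-Schmidt
operators `X`, `Y` are given by the families of their values on a Hilbert basis. -/
def redMatrix (e : HilbertBasis κ ℂ HS) (x y : lp (fun _ : ι => HTensor HS HE) 2) :
    lp (fun _ : κ × κ => ℂ) 2 :=
  ⟨fun p => ⟪lpMap ι (adjoint (tmulL HE (e p.2))) y, lpMap ι (adjoint (tmulL HE (e p.1))) x⟫_ℂ,
    memℓp_two_iff.mpr <| by
      have h := ((hasSum_norm_lpMap_adjoint_tmulL_sq e x).summable).mul_of_nonneg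
        ((hasSum_norm_lpMap_adjoint_tmulL_sq e y).summable) (fun _ => by positivity)
        (fun _ => by positivity)
      refine h.of_nonneg_of_le (fun _ => by positivity) fun p => ?_
      rw [← mul_pow, mul_comm]
      gcongr
      exact norm_inner_le_norm _ _⟩

theorem redMatrix_apply (e : HilbertBasis κ ℂ HS) (x y : lp (fun _ : ι => HTensor HS HE) 2)
    (p : κ × κ) : redMatrix e x y p =
      ⟪lpMap ι (adjoint (tmulL HE (e p.2))) y, lpMap ι (adjoint (tmulL HE (e p.1))) x⟫_ℂ := rfl

theorem hasSum_redMatrix (e : HilbertBasis κ ℂ HS) (x y : lp (fun _ : ι => HTensor HS HE) 2)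
    (p : κ × κ) : HasSum (fun l => ⟪adjoint (tmulL HE (e p.2)) (y l),
      adjoint (tmulL HE (e p.1)) (x l)⟫_ℂ) (redMatrix e x y p) :=
  lp.hasSum_inner (lpMap ι (adjoint (tmulL HE (e p.2))) y)
    (lpMap ι (adjoint (tmulL HE (e p.1))) x)

/-- Cauchy–Schwarz in each entry; the resulting double sum factors into the slice sums `‖x‖²` and
`‖y‖²`. -/
theorem norm_redMatrix_le (e : HilbertBasis κ ℂ HS) (x y : lp (fun _ : ι => HTensor HS HE) 2) :
    ‖redMatrix e x y‖ ≤ ‖x‖ * ‖y‖ := by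
  have hx := hasSum_norm_lpMap_adjoint_tmulL_sq e x
  have hy := hasSum_norm_lpMap_adjoint_tmulL_sq e y
  have h := hx.mul hy (hx.summable.mul_of_nonneg hy.summable (fun _ => by positivity)
    (fun _ => by positivity))
  refine le_of_sq_le_sq ?_ (by positivity)
  rw [mul_pow]
  refine hasSum_le (fun p => ?_) (lp_hasSum_norm_sq (redMatrix e x y)) h
  rw [← mul_pow, mul_comm]
  gcongr
  exact norm_inner_le_norm _ _

theorem redMatrix_smul_left (e : HilbertBasis κ ℂ HS) (c : ℂ)
    (x y : lp (fun _ : ι => HTensor HS HE) 2) :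
    redMatrix e (c • x) y = c • redMatrix e x y := by
  ext p
  simp [redMatrix_apply]

theorem redMatrix_smul_right (e : HilbertBasis κ ℂ HS) (c : ℂ)
    (x y : lp (fun _ : ι => HTensor HS HE) 2) :
    redMatrix e x (c • y) = (starRingEnd ℂ) c • redMatrix e x y := by
  ext p
  simp [redMatrix_apply, mul_comm]

/-- Real scalars are used because the dependence on `y` is conjugate linear. -/
theorem isBoundedBilinearMap_redMatrix (e : HilbertBasis κ ℂ HS) :
    IsBoundedBilinearMap ℝ fun p : lp (fun _ : ι => HTensor HS HE) 2 ×
      lp (fun _ : ι => HTensor HS HE) 2 => redMatrix e p.1 p.2 where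
  add_left x x' y := by ext p; simp [redMatrix_apply]
  smul_left c x y := by
    have := redMatrix_smul_left e c x y
    exact this
  add_right x y y' := by ext p; simp [redMatrix_apply]
  smul_right c x y := by
    have := redMatrix_smul_right e c x y
    rw [Complex.conj_ofReal] at this
    exact this
  bound := ⟨1, one_pos, fun x y => by rw [one_mul]; exact norm_redMatrix_le e x y⟩

end Bilinear

/-! ### Purity as a squared norm, and its derivatives -/

section Purity

open ContinuousLinearMap (adjoint adjoint_inner_left adjoint_inner_right)

variable {ι κ : Type*} {HS HE : Type*} [NormedAddCommGroup HS] [InnerProductSpace ℂ HS]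
  [CompleteSpace HS] [NormedAddCommGroup HE] [InnerProductSpace ℂ HE] [CompleteSpace HE]

theorem hasDerivAt_redMatrix (e : HilbertBasis κ ℂ HS)
    {x x' y y' : ℝ → lp (fun _ : ι => HTensor HS HE) 2} {t : ℝ}
    (hx : HasDerivAt x (x' t) t) (hy : HasDerivAt y (y' t) t) :
    HasDerivAt (fun t => redMatrix e (x t) (y t))
      (redMatrix e (x t) (y' t) + redMatrix e (x' t) (y t)) t := by
  have := ((isBoundedBilinearMap_redMatrix (ι := ι) (HE := HE) e).hasFDerivAt
    (x t, y t)).comp_hasDerivAt t (hx.prodMk hy)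
  exact this

theorem continuous_redMatrix (e : HilbertBasis κ ℂ HS)
    {x y : ℝ → lp (fun _ : ι => HTensor HS HE) 2} (hx : Continuous x) (hy : Continuous y) :
    Continuous fun t => redMatrix e (x t) (y t) := by
  have h := (isBoundedBilinearMap_redMatrix (ι := ι) (HE := HE) e).continuous
  have h2 := Continuous.comp h (Continuous.prodMk hx hy)
  exact h2

theorem hasDerivAt_re_inner {Z : Type*} [NormedAddCommGroup Z] [InnerProductSpace ℂ Z]
    {f g : ℝ → Z} {f' g' : Z} {t : ℝ} (hf : HasDerivAt f f' t) (hg : HasDerivAt g g' t) :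
    HasDerivAt (fun t => (⟪f t, g t⟫_ℂ).re) ((⟪f t, g'⟫_ℂ).re + (⟪f', g t⟫_ℂ).re) t := by
  have h := Complex.reCLM.hasFDerivAt.comp_hasDerivAt t (hf.inner ℂ hg)
  have h2 : Complex.reCLM (⟪f t, g'⟫_ℂ + ⟪f', g t⟫_ℂ) = (⟪f t, g'⟫_ℂ).re + (⟪f', g t⟫_ℂ).re := by
    simp
  rw [h2] at h
  exact h

theorem norm_sq_calculus {Z : Type*} [NormedAddCommGroup Z] [InnerProductSpace ℂ Z]
    {g g₁ g₂ : ℝ → Z} (hg : ∀ t, HasDerivAt g (g₁ t) t)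
    (hg₁ : ∀ t, HasDerivAt g₁ (g₂ t) t) (hg₂ : Continuous g₂) :
    ContDiff ℝ 2 (fun t => ‖g t‖ ^ 2) ∧
    (∀ t, deriv (fun t => ‖g t‖ ^ 2) t = 2 * (⟪g t, g₁ t⟫_ℂ).re) ∧
    (∀ t, deriv (deriv fun t => ‖g t‖ ^ 2) t = 2 * ‖g₁ t‖ ^ 2 + 2 * (⟪g t, g₂ t⟫_ℂ).re) := by
  have hp (z : Z) : ‖z‖ ^ 2 = (⟪z, z⟫_ℂ).re := (inner_self_eq_norm_sq (𝕜 := ℂ) z).symm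
  have hd (t) : HasDerivAt (fun t => ‖g t‖ ^ 2) (2 * (⟪g t, g₁ t⟫_ℂ).re) t := by
    simp only [hp]
    convert! hasDerivAt_re_inner (hg t) (hg t) using 1
    rw [two_mul, ← inner_conj_symm (g₁ t), Complex.conj_re]
  have hd1 := funext fun t => (hd t).deriv
  have hd2 (t) : HasDerivAt (deriv fun t => ‖g t‖ ^ 2)
      (2 * ‖g₁ t‖ ^ 2 + 2 * (⟪g t, g₂ t⟫_ℂ).re) t := by
    rw [hd1, hp, ← mul_add, add_comm]
    exact (hasDerivAt_re_inner (hg t) (hg₁ t)).const_mul (2 : ℝ)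
  refine ⟨?_, fun t => (hd t).deriv, fun t => (hd2 t).deriv⟩
  rw [show (2 : WithTop ℕ∞) = 1 + 1 from one_add_one_eq_two.symm, contDiff_succ_iff_deriv]
  refine ⟨fun t => (hd t).differentiableAt, by simp, ?_⟩
  rw [contDiff_one_iff_deriv]
  refine ⟨fun t => (hd2 t).differentiableAt, ?_⟩
  rw [funext fun t => (hd2 t).deriv]
  have c0 : Continuous g := continuous_iff_continuousAt.mpr fun t => (hg t).continuousAt
  have c1 : Continuous g₁ := continuous_iff_continuousAt.mpr fun t => (hg₁ t).continuousAt
  exact (continuous_const.mul (c1.norm.pow 2)).add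
    (continuous_const.mul (Complex.continuous_re.comp (c0.inner hg₂)))

/-- The first two derivatives of the squared norm of `redMatrix e x x` along a `C²` curve `x`. -/
theorem norm_redMatrix_sq_calculus (e : HilbertBasis κ ℂ HS)
    {x x₁ x₂ : ℝ → lp (fun _ : ι => HTensor HS HE) 2} (hx : ∀ t, HasDerivAt x (x₁ t) t)
    (hx₁ : ∀ t, HasDerivAt x₁ (x₂ t) t) (hx₂ : Continuous x₂) :
    ContDiff ℝ 2 (fun t => ‖redMatrix e (x t) (x t)‖ ^ 2) ∧
    (∀ t, deriv (fun t => ‖redMatrix e (x t) (x t)‖ ^ 2) t = 2 * (⟪redMatrix e (x t) (x t),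
      redMatrix e (x t) (x₁ t) + redMatrix e (x₁ t) (x t)⟫_ℂ).re) ∧
    (∀ t, deriv (deriv fun t => ‖redMatrix e (x t) (x t)‖ ^ 2) t =
      2 * ‖redMatrix e (x t) (x₁ t) + redMatrix e (x₁ t) (x t)‖ ^ 2 +
      2 * (⟪redMatrix e (x t) (x t), redMatrix e (x t) (x₂ t) + redMatrix e (x₁ t) (x₁ t) +
        (redMatrix e (x₁ t) (x₁ t) + redMatrix e (x₂ t) (x t))⟫_ℂ).re) := by
  have c0 : Continuous x := continuous_iff_continuousAt.mpr fun t => (hx t).continuousAt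
  have c1 : Continuous x₁ := continuous_iff_continuousAt.mpr fun t => (hx₁ t).continuousAt
  have h1 (t) : HasDerivAt (fun t => redMatrix e (x t) (x₁ t) + redMatrix e (x₁ t) (x t))
      (redMatrix e (x t) (x₂ t) + redMatrix e (x₁ t) (x₁ t) +
        (redMatrix e (x₁ t) (x₁ t) + redMatrix e (x₂ t) (x t))) t :=
    (hasDerivAt_redMatrix e (hx t) (hx₁ t)).fun_add (hasDerivAt_redMatrix e (hx₁ t) (hx t))
  have h2 : Continuous fun t => redMatrix e (x t) (x₂ t) + redMatrix e (x₁ t) (x₁ t) +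
      (redMatrix e (x₁ t) (x₁ t) + redMatrix e (x₂ t) (x t)) :=
    ((continuous_redMatrix e c0 hx₂).fun_add (continuous_redMatrix e c1 c1)).fun_add
      ((continuous_redMatrix e c1 c1).fun_add (continuous_redMatrix e hx₂ c0))
  exact norm_sq_calculus (fun t => hasDerivAt_redMatrix e (hx t) (hx t)) h1 h2

theorem IsTraceClass.isHS {H : Type*} [NormedAddCommGroup H] [InnerProductSpace ℂ H]
    [CompleteSpace H] {T : H →L[ℂ] H} (h : IsTraceClass T) : IsHS T := by
  obtain ⟨A, B, hA, hB, rfl⟩ := h.exists_comp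
  exact hB.comp_left A

/-- Self-adjointness turns `tr T²` into the squared Hilbert–Schmidt norm of `T`. -/
theorem hasSum_purity {H : Type*} [NormedAddCommGroup H] [InnerProductSpace ℂ H]
    [CompleteSpace H] {T : H →L[ℂ] H} (h : IsTraceClass T) (hT : T.IsPositive)
    (e : HilbertBasis κ ℂ H) : HasSum (fun i => ‖T (e i)‖ ^ 2) (purity T) := by
  refine (Complex.hasSum_re (hasSum_trace_comp e h.isHS h.isHS)).congr_fun fun i => ?_
  rw [← inner_self_eq_norm_sq (𝕜 := ℂ), ← adjoint_inner_right, hT.isSelfAdjoint.adjoint_eq]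
  rfl

theorem purity_partialTrace {X : HTensor HS HE →L[ℂ] HTensor HS HE} (hX : IsHS X)
    (e : HilbertBasis κ ℂ HS) (b : HilbertBasis ι ℂ (HTensor HS HE)) :
    purity (partialTrace (X ∘L adjoint X)) = ‖redMatrix e (hsVec b X hX) (hsVec b X hX)‖ ^ 2 := by
  have h1 := lp_hasSum_norm_sq (redMatrix e (hsVec b X hX) (hsVec b X hX))
  have h2 (p : κ × κ) : redMatrix e (hsVec b X hX) (hsVec b X hX) p =
      ⟪e p.1, partialTrace (X ∘L adjoint X) (e p.2)⟫_ℂ :=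
    (hasSum_redMatrix e _ _ p).unique (hasSum_inner_partialTrace hX b _ _)
  simp only [h2] at h1
  refine (hasSum_purity (partialTrace_spec hX).1 (isPositive_partialTrace hX) e).unique ?_
  exact ((Equiv.prodComm κ κ).hasSum_iff.mpr h1).prod_fiberwise fun j =>
    hasSum_norm_inner_sq e (partialTrace (X ∘L adjoint X) (e j))

theorem reducedState_eq {U : ℝ → HTensor HS HE →L[ℂ] HTensor HS HE}
    (A : HTensor HS HE →L[ℂ] HTensor HS HE) (t : ℝ) :
    reducedState U (A ∘L adjoint A) t = partialTrace ((U t ∘L A) ∘L adjoint (U t ∘L A)) := by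
  rw [reducedState, ContinuousLinearMap.adjoint_comp]
  rfl

/-- Test the partial trace against `B = 1`, then use cyclicity and `U* U = 1`. -/
theorem trace_reducedState {ham : HTensor HS HE →ₗ.[ℂ] HTensor HS HE}
    {U : ℝ → HTensor HS HE →L[ℂ] HTensor HS HE} (hU : IsPropagator ham U)
    {A : HTensor HS HE →L[ℂ] HTensor HS HE} (hA : IsHS A) (t : ℝ) :
    trace (reducedState U (A ∘L adjoint A) t) = trace (A ∘L adjoint A) := by
  have hX := hA.comp_left (U t)
  have h1 := (partialTrace_spec hX).2 1
  have h2 : adjoint (U t) ∘L U t = 1 := (Unitary.mem_iff.mp (hU.unitary t)).1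
  rw [opTensor_one] at h1
  rw [reducedState_eq]
  refine Eq.trans h1 ?_
  have h3 : adjoint (U t ∘L A) ∘L (U t ∘L A) = adjoint A ∘L A := by
    rw [ContinuousLinearMap.adjoint_comp, ContinuousLinearMap.comp_assoc,
      ← ContinuousLinearMap.comp_assoc (adjoint (U t)), h2]
    rfl
  have h4 := trace_comp_comm hX hX.adjoint
  rw [h3, ← trace_comp_comm hA hA.adjoint] at h4
  exact h4

theorem isDensityMatrix_reducedState {ham : HTensor HS HE →ₗ.[ℂ] HTensor HS HE}
    {U : ℝ → HTensor HS HE →L[ℂ] HTensor HS HE} (hU : IsPropagator ham U)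
    {A : HTensor HS HE →L[ℂ] HTensor HS HE} (hA : IsHS A) (h1 : trace (A ∘L adjoint A) = 1)
    (t : ℝ) : IsDensityMatrix (reducedState U (A ∘L adjoint A) t) := by
  refine ⟨?_, ?_, (trace_reducedState hU hA t).trans h1⟩
  · rw [reducedState_eq]
    exact isPositive_partialTrace (hA.comp_left (U t))
  · rw [reducedState_eq]
    exact (partialTrace_spec (hA.comp_left (U t))).1

theorem IsPureState.purity_eq_one {H : Type*} [NormedAddCommGroup H] [InnerProductSpace ℂ H]
    [CompleteSpace H] {T : H →L[ℂ] H} (h : IsPureState T) : purity T = 1 := by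
  obtain ⟨φ, hφ, rfl⟩ := h
  have : proj φ ∘L proj φ = proj φ := by
    ext x
    simp [proj, hφ]
  rw [purity, this, proj, trace_rankOne, inner_self_eq_norm_sq_to_K, hφ]
  simp

end Purity

/-! ### The derivatives at time zero for a product initial state -/

section SecondDerivative

open ContinuousLinearMap (adjoint adjoint_inner_left adjoint_inner_right)

variable {ι κ : Type*} {HS HE : Type*} [NormedAddCommGroup HS] [InnerProductSpace ℂ HS]
  [CompleteSpace HS] [NormedAddCommGroup HE] [InnerProductSpace ℂ HE] [CompleteSpace HE]

theorem norm_tmul' (s : HS) (e : HE) : ‖tmul s e‖ = ‖s‖ * ‖e‖ := by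
  simp [tmul]

theorem opTensor_one_sub_proj (ψ : HS) (z : HTensor HS HE) :
    opTensor (1 - proj ψ) 1 z = z - tmul ψ (adjoint (tmulL HE ψ) z) := by
  rw [opTensor_sub, opTensor_one, proj, opTensor_rankOne]
  rfl

theorem norm_opTensor_one_sub_proj_sq {ψ : HS} (hψ : ‖ψ‖ = 1) (z : HTensor HS HE) :
    ‖opTensor (1 - proj ψ) 1 z‖ ^ 2 = ‖z‖ ^ 2 - ‖adjoint (tmulL HE ψ) z‖ ^ 2 := by
  rw [opTensor_one_sub_proj, norm_sub_sq (𝕜 := ℂ), norm_tmul', hψ, one_mul, ← tmulL_apply,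
    ← adjoint_inner_left, inner_self_eq_norm_sq]
  ring

theorem inner_self_eq_ofReal {H : Type*} [NormedAddCommGroup H] [InnerProductSpace ℂ H] (x : H) :
    ⟪x, x⟫_ℂ = ((‖x‖ ^ 2 : ℝ) : ℂ) := by
  rw [inner_self_eq_norm_sq_to_K]
  norm_cast

theorem redMatrix_conj (e : HilbertBasis κ ℂ HS) (x y : lp (fun _ : ι => HTensor HS HE) 2)
    (i j : κ) : (starRingEnd ℂ) (redMatrix e x y (i, j)) = redMatrix e y x (j, i) := by
  rw [redMatrix_apply, redMatrix_apply, inner_conj_symm]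

/-- Evaluates the norm of a matrix supported on the row and column of `i₀`. The entry `(i₀, i₀)` is
counted twice, which is harmless in the application, where `w i₀ = 0`. -/
theorem hasSum_pair {w : κ → ℝ} {c : ℝ} (hw : HasSum w c) (i₀ : κ) [DecidableEq κ] :
    HasSum (fun p : κ × κ => (if p.2 = i₀ then w p.1 else 0) + if p.1 = i₀ then w p.2 else 0)
      (c + c) := by
  refine HasSum.add ?_ ?_
  · refine (Function.Injective.hasSum_iff (g := fun i : κ => (i, i₀))
      (fun i j h => by simpa using h) ?_).mp (by simpa [Function.comp_def] using hw)
    rintro ⟨i, j⟩ h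
    rw [if_neg]
    rintro rfl
    exact h ⟨i, rfl⟩
  · refine (Function.Injective.hasSum_iff (g := fun i : κ => (i₀, i))
      (fun i j h => by simpa using h) ?_).mp (by simpa [Function.comp_def] using hw)
    rintro ⟨i, j⟩ h
    rw [if_neg]
    rintro rfl
    exact h ⟨j, rfl⟩

section Entries

variable {e : HilbertBasis κ ℂ HS} {i₀ : κ} {ψ η : HS} (hi₀ : e i₀ = ψ) (hψ : ‖ψ‖ = 1)
  {X Y Z W : lp (fun _ : ι => HTensor HS HE) 2} {α : ι → HE} (hX : ∀ l, X l = tmul ψ (α l))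
  (hα : HasSum (fun l => ‖α l‖ ^ 2) 1)

include hX hi₀

/-- A family with system factor `ψ` has no slice along the other basis vectors, so only the column
of `i₀` survives. -/
theorem redMatrix_product_eq_zero (T : lp (fun _ : ι => HTensor HS HE) 2) (i : κ) {j : κ}
    (hj : j ≠ i₀) : redMatrix e T X (i, j) = 0 := by
  refine ((hasSum_redMatrix e T X (i, j)).congr_fun fun l => ?_).unique hasSum_zero
  rw [hX, adjoint_tmulL_tmul, ← hi₀, e.orthonormal.2 hj, zero_smul, inner_zero_left]

include hψ

theorem hasSum_redMatrix_product (T : lp (fun _ : ι => HTensor HS HE) 2) (i : κ) :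
    HasSum (fun l => ⟪tmul (e i) (α l), T l⟫_ℂ) (redMatrix e T X (i, i₀)) := by
  refine (hasSum_redMatrix e T X (i, i₀)).congr_fun fun l => ?_
  rw [hX, adjoint_tmulL_tmul, hi₀, inner_self_eq_norm_sq_to_K, hψ, adjoint_inner_right]
  simp

theorem hasSum_redMatrix_product_diag (T : lp (fun _ : ι => HTensor HS HE) 2) :
    HasSum (fun l => ⟪X l, T l⟫_ℂ) (redMatrix e T X (i₀, i₀)) := by
  refine (hasSum_redMatrix_product hi₀ hψ hX T i₀).congr_fun fun l => ?_
  rw [hX, hi₀]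

theorem redMatrix_product_conj (hXY : ∀ l, ⟪Y l, X l⟫_ℂ = ⟪X l, Y l⟫_ℂ) :
    redMatrix e X Y (i₀, i₀) = redMatrix e Y X (i₀, i₀) := by
  refine (hasSum_redMatrix e X Y (i₀, i₀)).unique ?_
  refine (hasSum_redMatrix_product_diag hi₀ hψ hX Y).congr_fun fun l => ?_
  rw [← hXY, hX, adjoint_tmulL_tmul, hi₀, inner_self_eq_norm_sq_to_K, hψ, ← tmulL_apply,
    ← adjoint_inner_left]
  simp

/-- For `Y = ham A` and `Z = ham² A` the hypothesis is the symmetry `⟨A, ham² A⟩ = ⟨ham A, ham A⟩`.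
-/
theorem redMatrix_product_sq (hZ : ∀ l, ⟪X l, Z l⟫_ℂ = ⟪Y l, Y l⟫_ℂ) :
    redMatrix e Z X (i₀, i₀) = ((‖Y‖ ^ 2 : ℝ) : ℂ) := by
  refine (hasSum_redMatrix_product_diag hi₀ hψ hX Z).unique ?_
  refine (Complex.hasSum_ofReal.mpr (lp_hasSum_norm_sq Y)).congr_fun fun l => ?_
  rw [hZ, inner_self_eq_ofReal]

include hα

theorem redMatrix_product_self [DecidableEq κ] :
    redMatrix e X X = lp.single 2 (i₀, i₀) (1 : ℂ) := by
  ext ⟨i, j⟩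
  rw [lp.single_apply]
  by_cases hj : j = i₀
  · subst hj
    by_cases hi : i = j
    · subst hi
      rw [Pi.single_eq_same]
      have h1 := Complex.hasSum_ofReal.mpr hα
      rw [Complex.ofReal_one] at h1
      refine (hasSum_redMatrix_product hi₀ hψ hX X i).unique (h1.congr_fun fun l => ?_)
      rw [hX, hi₀, inner_self_eq_ofReal, norm_tmul', hψ, one_mul]
    · rw [Pi.single_eq_of_ne (by simpa using hi)]
      refine (hasSum_redMatrix_product hi₀ hψ hX X i).unique (hasSum_zero.congr_fun fun l => ?_)
      rw [hX, inner_tmul, ← hi₀, e.orthonormal.2 hi, zero_mul]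
  · rw [Pi.single_eq_of_ne (by simp [hj]), redMatrix_product_eq_zero hi₀ hX X i hj]

variable (hQ : ∀ l, opTensor (1 - proj ψ) 1 (Y l) = tmul η (α l) + W l)
  (h0 : ∀ s, HasSum (fun l => ⟪tmul s (α l), W l⟫_ℂ) 0)

include hQ h0

/-- For `eᵢ ⊥ ψ` only `Q Y = η ⊗ α + W` contributes; `W` drops out by `h0` and `∑ ‖α l‖² = 1` leaves
the component of `η`. -/
theorem redMatrix_product_offdiag {i : κ} (hi : i ≠ i₀) :
    redMatrix e Y X (i, i₀) = ⟪e i, η⟫_ℂ := by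
  refine (hasSum_redMatrix_product hi₀ hψ hX Y i).unique ?_
  have h3 := ((Complex.hasSum_ofReal.mpr hα).mul_left ⟪e i, η⟫_ℂ).add (h0 (e i))
  rw [Complex.ofReal_one, mul_one, add_zero] at h3
  refine h3.congr_fun fun l => ?_
  rw [← inner_self_eq_ofReal, ← inner_tmul, ← inner_add_right, ← hQ, opTensor_one_sub_proj,
    inner_sub_right, inner_tmul (e i) ψ, ← hi₀, e.orthonormal.2 hi, zero_mul, sub_zero]

/-- The entry is the squared norm of the slice of `Y` along `ψ`, that is `‖Y‖² - ‖Q Y‖²`; by `h0`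
the two parts of `Q Y` are orthogonal. -/
theorem redMatrix_diag : redMatrix e Y Y (i₀, i₀) =
    ((‖Y‖ ^ 2 - (‖η‖ ^ 2 + ‖W‖ ^ 2) : ℝ) : ℂ) := by
  have h3 := ((hα.mul_left (‖η‖ ^ 2)).add ((Complex.hasSum_re (h0 η)).mul_left 2)).add
    (lp_hasSum_norm_sq W)
  rw [mul_one, Complex.zero_re, mul_zero, add_zero] at h3
  refine (hasSum_redMatrix e Y Y (i₀, i₀)).unique
    ((Complex.hasSum_ofReal.mpr ((lp_hasSum_norm_sq Y).sub h3)).congr_fun fun l => ?_)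
  have h4 := norm_opTensor_one_sub_proj_sq hψ (Y l)
  rw [hQ, norm_add_sq (𝕜 := ℂ), norm_tmul', mul_pow] at h4
  rw [hi₀, inner_self_eq_ofReal]
  congr 1
  have h5 : RCLike.re ⟪tmul η (α l), W l⟫_ℂ = (⟪tmul η (α l), W l⟫_ℂ).re := rfl
  rw [h5] at h4
  linear_combination h4

theorem norm_commutator_sq [DecidableEq κ] (hη : ⟪ψ, η⟫_ℂ = 0)
    (hXY : ∀ l, ⟪Y l, X l⟫_ℂ = ⟪X l, Y l⟫_ℂ) :
    ‖redMatrix e X Y - redMatrix e Y X‖ ^ 2 = ‖η‖ ^ 2 + ‖η‖ ^ 2 := by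
  refine (lp_hasSum_norm_sq _).unique ((hasSum_pair (hasSum_norm_inner_sq e η) i₀).congr_fun ?_)
  rintro ⟨i, j⟩
  rw [lp.coeFn_sub, Pi.sub_apply]
  dsimp only
  by_cases hj : j = i₀
  · subst hj
    by_cases hi : i = j
    · subst hi
      rw [redMatrix_product_conj hi₀ hψ hX hXY, sub_self, if_pos rfl, hi₀, hη]
      simp
    · rw [← redMatrix_conj e Y X j i, redMatrix_product_eq_zero hi₀ hX Y j hi,
        redMatrix_product_offdiag hi₀ hψ hX hα hQ h0 hi, if_pos rfl, if_neg hi]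
      simp
  · rw [redMatrix_product_eq_zero hi₀ hX Y i hj, if_neg hj, sub_zero, ← redMatrix_conj e Y X j i,
      RCLike.norm_conj, zero_add]
    by_cases hi : i = i₀
    · subst hi
      rw [redMatrix_product_offdiag hi₀ hψ hX hα hQ h0 hj, if_pos rfl]
    · rw [redMatrix_product_eq_zero hi₀ hX Y j hi, if_neg hi]
      simp

end Entries

/-- The derivatives at time zero of the squared norm of `redMatrix e x x` along a curve `x` that
solves the Schrödinger equation and starts at a product state. -/
theorem norm_redMatrix_product_calculus {e : HilbertBasis κ ℂ HS} {i₀ : κ} {ψ η : HS}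
    (hi₀ : e i₀ = ψ) (hψ : ‖ψ‖ = 1) {x y z : ℝ → lp (fun _ : ι => HTensor HS HE) 2}
    {W : lp (fun _ : ι => HTensor HS HE) 2} {α : ι → HE} (hX : ∀ l, x 0 l = tmul ψ (α l))
    (hα : HasSum (fun l => ‖α l‖ ^ 2) 1)
    (hQ : ∀ l, opTensor (1 - proj ψ) 1 (y 0 l) = tmul η (α l) + W l)
    (h0 : ∀ s, HasSum (fun l => ⟪tmul s (α l), W l⟫_ℂ) 0) (hη : ⟪ψ, η⟫_ℂ = 0)
    (hXY : ∀ l, ⟪y 0 l, x 0 l⟫_ℂ = ⟪x 0 l, y 0 l⟫_ℂ)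
    (hXZ : ∀ l, ⟪x 0 l, z 0 l⟫_ℂ = ⟪y 0 l, y 0 l⟫_ℂ)
    (hx : ∀ t, HasDerivAt x (-Complex.I • y t) t) (hy : ∀ t, HasDerivAt y (-Complex.I • z t) t)
    (hz : Continuous z) {p : ℝ → ℝ} (hp : p = fun t => ‖redMatrix e (x t) (x t)‖ ^ 2) :
    ContDiff ℝ 2 p ∧ p 0 = 1 ∧ deriv p 0 = 0 ∧ deriv (deriv p) 0 = -4 * ‖W‖ ^ 2 := by
  classical
  obtain ⟨hC, hd1, hd2⟩ := norm_redMatrix_sq_calculus e hx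
    (fun t => (hy t).fun_const_smul (-Complex.I)) ((hz.fun_const_smul _).fun_const_smul _)
  rw [← hp] at hC hd1 hd2
  replace hd1 := hd1 0
  replace hd2 := hd2 0
  have hxx := redMatrix_product_self hi₀ hψ hX hα
  have hxy := redMatrix_product_conj hi₀ hψ hX hXY
  have hzx := redMatrix_product_sq hi₀ hψ hX hXZ
  have hyy := redMatrix_diag hi₀ hψ hX hα hQ h0
  have hN := norm_commutator_sq hi₀ hψ hX hα hQ h0 hη hXY
  have hxz : redMatrix e (x 0) (z 0) (i₀, i₀) = redMatrix e (z 0) (x 0) (i₀, i₀) := by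
    rw [← redMatrix_conj, hzx, Complex.conj_ofReal]
  -- Pairing with the matrix unit at `(i₀, i₀)` reads off that entry.
  have hin (z : lp (fun _ : κ × κ => ℂ) 2) : ⟪redMatrix e (x 0) (x 0), z⟫_ℂ = z (i₀, i₀) := by
    rw [hxx, lp.inner_single_left]
    simp
  rw [hin] at hd1 hd2
  simp only [redMatrix_smul_left, redMatrix_smul_right] at hd1 hd2
  have hN' : (starRingEnd ℂ) (-Complex.I) • redMatrix e (x 0) (y 0) +
      -Complex.I • redMatrix e (y 0) (x 0) =
      Complex.I • (redMatrix e (x 0) (y 0) - redMatrix e (y 0) (x 0)) := by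
    rw [map_neg, Complex.conj_I, neg_neg, smul_sub, neg_smul, sub_eq_add_neg]
  rw [hN'] at hd1 hd2
  refine ⟨hC, ?_, ?_, ?_⟩
  · rw [hp]
    dsimp only
    rw [hxx, lp.norm_single (by norm_num)]
    simp
  · rw [hd1, lp.coeFn_smul, Pi.smul_apply, lp.coeFn_sub, Pi.sub_apply, hxy, sub_self]
    simp
  -- The commutator gives `4‖η‖²` and the entry of the second derivative gives `-4(‖η‖² + ‖W‖²)`.
  · rw [hd2, norm_smul, Complex.norm_I, one_mul, hN]
    simp only [lp.coeFn_add, Pi.add_apply, lp.coeFn_smul, Pi.smul_apply, hxz, hzx, hyy,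
      smul_eq_mul, map_neg, Complex.conj_I, neg_neg]
    simp only [← mul_assoc, neg_mul, mul_neg, Complex.I_mul_I, neg_neg, one_mul]
    simp only [Complex.add_re, Complex.neg_re, Complex.ofReal_re]
    ring

theorem hasSum_norm_sq_eq_one {A : HTensor HS HE →L[ℂ] HTensor HS HE} {a : HTensor HS HE →L[ℂ] HE}
    {ψ : HS} (b : HilbertBasis ι ℂ (HTensor HS HE)) (hψ : ‖ψ‖ = 1) (hA : IsHS A)
    (ha : ∀ x, A x = tmul ψ (a x)) (hA1 : trace (A ∘L adjoint A) = 1) :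
    HasSum (fun l => ‖a (b l)‖ ^ 2) 1 := by
  have h := Complex.hasSum_re (hasSum_inner_of_isHS b hA hA)
  rw [hA1] at h
  refine h.congr_fun fun l => ?_
  rw [inner_self_eq_ofReal, ha, norm_tmul', hψ, one_mul, Complex.ofReal_re]

/-- The derivatives at time zero of the purity of the reduced state, for a product initial state
`A A*` with `A x = ψ ⊗ a x`, where `Q A₁ x = η ⊗ a x + W x`, `A₁ = ham A` and
`Q = (1 - |ψ⟩⟨ψ|) ⊗ 1`. -/
theorem purity_reducedState_calculus {ham : HTensor HS HE →ₗ.[ℂ] HTensor HS HE}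
    {U : ℝ → HTensor HS HE →L[ℂ] HTensor HS HE} {A A₁ A₂ W : HTensor HS HE →L[ℂ] HTensor HS HE}
    {a : HTensor HS HE →L[ℂ] HE} {ψ η : HS} (hU : IsPropagator ham U)
    (hsym : ∀ x y x' y', (x, y) ∈ ham.graph → (x', y') ∈ ham.graph → ⟪y, x'⟫_ℂ = ⟪x, y'⟫_ℂ)
    (hA : IsHS A) (hA₁ : IsHS A₁) (hA₂ : IsHS A₂) (h₁ : ∀ x, (A x, A₁ x) ∈ ham.graph)
    (h₂ : ∀ x, (A₁ x, A₂ x) ∈ ham.graph) (hψ : ‖ψ‖ = 1) (ha : ∀ x, A x = tmul ψ (a x))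
    (hA1 : trace (A ∘L adjoint A) = 1) (hη : ⟪ψ, η⟫_ℂ = 0) (hW : IsHS W)
    (hQ : ∀ x, opTensor (1 - proj ψ) 1 (A₁ x) = tmul η (a x) + W x)
    (b : HilbertBasis ι ℂ (HTensor HS HE))
    (h0 : ∀ s, HasSum (fun l => ⟪tmul s (a (b l)), W (b l)⟫_ℂ) 0) {p : ℝ → ℝ}
    (hp : p = fun t => purity (reducedState U (A ∘L adjoint A) t)) :
    ContDiff ℝ 2 p ∧ p 0 = 1 ∧ deriv p 0 = 0 ∧
      deriv (deriv p) 0 = -4 * ∑' l, ‖W (b l)‖ ^ 2 := by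
  -- The purity may be computed in any basis; one containing `ψ` makes the initial matrix a matrix
  -- unit.
  obtain ⟨w, e, hw, he⟩ : ∃ (w : Set HS) (e : HilbertBasis w ℂ HS), {ψ} ⊆ w ∧ ⇑e = ((↑) : w → HS) :=
    Orthonormal.exists_hilbertBasis_extension (𝕜 := ℂ) (s := {ψ}) (by
      classical
      rw [orthonormal_iff_ite]
      rintro ⟨x, rfl⟩ ⟨y, rfl⟩
      simp [inner_self_eq_norm_sq_to_K, hψ])
  have hi₀ : e ⟨ψ, hw rfl⟩ = ψ := by rw [he]
  have hU0 (T : HTensor HS HE →L[ℂ] HTensor HS HE) : U 0 ∘L T = T := by rw [hU.zero]; rfl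
  have hWn : ‖hsVec b W hW‖ ^ 2 = ∑' l, ‖W (b l)‖ ^ 2 :=
    (lp_hasSum_norm_sq (hsVec b W hW)).tsum_eq.symm
  rw [← hWn]
  refine norm_redMatrix_product_calculus (η := η) (W := hsVec b W hW) (α := fun l => a (b l)) hi₀ hψ
    (x := fun t => hsVec b (U t ∘L A) (hA.comp_left (U t)))
    (y := fun t => hsVec b (U t ∘L A₁) (hA₁.comp_left (U t)))
    (z := fun t => hsVec b (U t ∘L A₂) (hA₂.comp_left (U t)))
    (fun l => ?_) (hasSum_norm_sq_eq_one b hψ hA ha hA1) (fun l => ?_) h0 hη (fun l => ?_)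
    (fun l => ?_) (hU.hasDerivAt_hsVec b hA hA₁ h₁) (hU.hasDerivAt_hsVec b hA₁ hA₂ h₂)
    (hU.continuous_hsVec b hA₂) ?_
  · rw [hsVec_apply, hU0, ha]
  · rw [hsVec_apply, hU0, hQ, hsVec_apply]
  · simp only [hsVec_apply, hU0]
    exact hsym _ _ _ _ (h₁ (b l)) (h₁ (b l))
  · simp only [hsVec_apply, hU0]
    exact (hsym _ _ _ _ (h₁ (b l)) (h₂ (b l))).symm
  · rw [hp]
    funext t
    rw [reducedState_eq, purity_partialTrace (hA.comp_left (U t)) e b]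

end SecondDerivative

/-! ### Unbounded operators through their graphs -/

section Graphs

variable {H K : Type*} [NormedAddCommGroup H] [InnerProductSpace ℂ H]
  [NormedAddCommGroup K] [InnerProductSpace ℂ K]

theorem mem_graph_bdd {T : H →L[ℂ] H} {x y : H} : (x, y) ∈ (bdd T).graph ↔ y = T x := by
  rw [LinearPMap.mem_graph_iff]
  constructor
  · rintro ⟨z, rfl, rfl⟩
    rfl
  · rintro rfl
    exact ⟨⟨x, trivial⟩, rfl, rfl⟩

theorem mem_graph_comp {A B : H →ₗ.[ℂ] H} {x z : H} :
    (x, z) ∈ (comp A B).graph ↔ ∃ y, (x, y) ∈ B.graph ∧ (y, z) ∈ A.graph := by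
  constructor
  · intro h
    obtain ⟨⟨_, y, hy, rfl⟩, rfl, rfl⟩ := (LinearPMap.mem_graph_iff _).mp h
    exact ⟨B y, B.mem_graph y, A.mem_graph ⟨B y, hy⟩⟩
  · rintro ⟨y, h1, h2⟩
    obtain ⟨x, rfl, rfl⟩ := (LinearPMap.mem_graph_iff _).mp h1
    obtain ⟨y, hy, rfl⟩ := (LinearPMap.mem_graph_iff _).mp h2
    have hx : B x ∈ A.domain := by
      have := y.2
      rwa [hy] at this
    obtain rfl : y = ⟨B x, hx⟩ := Subtype.ext hy
    exact (LinearPMap.mem_graph_iff _).mpr ⟨⟨x, x, hx, rfl⟩, rfl, rfl⟩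

theorem mem_graph_comp_bdd {A : H →ₗ.[ℂ] H} {T : H →L[ℂ] H} {x z : H} :
    (x, z) ∈ (comp A (bdd T)).graph ↔ (T x, z) ∈ A.graph := by
  simp only [mem_graph_comp, mem_graph_bdd, exists_eq_left]

theorem graph_functional {A : H →ₗ.[ℂ] H} {x y z : H} (h1 : (x, y) ∈ A.graph)
    (h2 : (x, z) ∈ A.graph) : y = z :=
  A.mem_graph_snd_inj h1 h2 rfl

theorem graph_zero {A : H →ₗ.[ℂ] H} {y : H} (h : ((0 : H), y) ∈ A.graph) : y = 0 :=
  graph_functional h A.graph.zero_mem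

theorem IsBoundedExtension.apply_eq {A : H →ₗ.[ℂ] H} {T : H →L[ℂ] H}
    (h : IsBoundedExtension A T) {x y : H} (hxy : (x, y) ∈ A.graph) : T x = y := by
  obtain ⟨z, rfl, rfl⟩ := (LinearPMap.mem_graph_iff _).mp hxy
  exact h.2 z

theorem isBoundedExtension_of_graph {A : H →ₗ.[ℂ] H} {T : H →L[ℂ] H}
    (h : ∀ x, (x, T x) ∈ A.graph) : IsBoundedExtension A T := by
  have hd (x : H) : x ∈ A.domain := LinearPMap.mem_domain_of_mem_graph (h x)
  refine ⟨?_, fun x => graph_functional (h x) (A.mem_graph x)⟩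
  rw [show (A.domain : Set H) = Set.univ from Set.eq_univ_of_forall hd]
  exact dense_univ

theorem extend_eq {A : H →ₗ.[ℂ] H} {T : H →L[ℂ] H} (h : IsBoundedExtension A T) :
    extend A = T := by
  have h' : ∃ T, IsBoundedExtension A T := ⟨T, h⟩
  rw [extend, dif_pos h']
  exact DFunLike.coe_injective (Continuous.ext_on h.1 h'.choose.continuous T.continuous
    fun x hx => (h'.choose_spec.2 ⟨x, hx⟩).trans (h.2 ⟨x, hx⟩).symm)

theorem graph_of_dense {A : H →ₗ.[ℂ] H} (hA : A.IsClosed) {C D : K →L[ℂ] H} {S : Set K}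
    (hS : Dense S) (h : ∀ x ∈ S, (C x, D x) ∈ A.graph) (x : K) : (C x, D x) ∈ A.graph := by
  have hc : IsClosed {x : K | (C x, D x) ∈ A.graph} :=
    IsClosed.preimage (C.continuous.prodMk D.continuous) hA
  have := hc.closure_subset_iff.mpr h
  exact this (hS.closure_eq ▸ Set.mem_univ x)

theorem graph_comp_bdd_of_closed {A : H →ₗ.[ℂ] H} (hA : A.IsClosed) {R T : H →L[ℂ] H}
    (h : IsBoundedExtension (comp A (bdd R)) T) (x : H) : (R x, T x) ∈ A.graph := by
  refine graph_of_dense hA h.1 (fun x hx => ?_) x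
  have := (comp A (bdd R)).mem_graph ⟨x, hx⟩
  rw [mem_graph_comp_bdd, ← h.2] at this
  exact this

/-- Closedness of `A` upgrades the bounded extensions of `A R` and `A² R` to identities on the whole
space, so no domain question remains afterwards. -/
theorem HamiltonianRegular.exists_graph [CompleteSpace H] {A : H →ₗ.[ℂ] H} (hA : A.IsClosed)
    {R : H →L[ℂ] H} (h : HamiltonianRegular 2 A R) :
    ∃ T₁ T₂ : H →L[ℂ] H, IsHS T₁ ∧ IsHS T₂ ∧ (∀ x, (R x, T₁ x) ∈ A.graph) ∧
      ∀ x, (T₁ x, T₂ x) ∈ A.graph := by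
  obtain ⟨T₁, hT₁, hs₁⟩ := h 1 (by norm_num)
  obtain ⟨T₂, hT₂, hs₂⟩ := h 2 le_rfl
  have h1 (x) : (R x, T₁ x) ∈ A.graph := by
    refine graph_of_dense hA hT₁.1 (fun x hx => ?_) x
    have := (comp (power A 1) (bdd R)).mem_graph ⟨x, hx⟩
    rw [← hT₁.2] at this
    simp only [power, mem_graph_comp_bdd] at this
    exact this
  refine ⟨T₁, T₂, isHilbertSchmidt_iff.mp hs₁, isHilbertSchmidt_iff.mp hs₂, h1, fun x => ?_⟩
  refine graph_of_dense hA hT₂.1 (fun x hx => ?_) x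
  have := (comp (power A 2) (bdd R)).mem_graph ⟨x, hx⟩
  rw [← hT₂.2] at this
  simp only [power, mem_graph_comp_bdd] at this
  rw [mem_graph_comp] at this
  obtain ⟨y, hy, hy'⟩ := this
  rw [mem_graph_comp_bdd] at hy
  obtain rfl : y = T₁ x := graph_functional hy (h1 x)
  exact hy'

variable [CompleteSpace H]

theorem graph_symmetric {A : H →ₗ.[ℂ] H} (hA : IsSelfAdjoint A) {x y x' y' : H}
    (h : (x, y) ∈ A.graph) (h' : (x', y') ∈ A.graph) : ⟪y, x'⟫_ℂ = ⟪x, y'⟫_ℂ := by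
  have h1 := LinearPMap.adjoint_isFormalAdjoint hA.dense_domain
  rw [LinearPMap.isSelfAdjoint_def.mp hA] at h1
  obtain ⟨x, rfl, rfl⟩ := (LinearPMap.mem_graph_iff _).mp h
  obtain ⟨x', rfl, rfl⟩ := (LinearPMap.mem_graph_iff _).mp h'
  exact h1 x x'

theorem mem_graph_of_inner {A : H →ₗ.[ℂ] H} (hA : IsSelfAdjoint A) {v w : H}
    (h : ∀ x y, (x, y) ∈ A.graph → ⟪w, x⟫_ℂ = ⟪v, y⟫_ℂ) : (v, w) ∈ A.graph := by
  have h1 (x : A.domain) : ⟪w, x⟫_ℂ = ⟪v, A x⟫_ℂ := h x (A x) (A.mem_graph x)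
  have hv : v ∈ (LinearPMap.adjoint A).domain := LinearPMap.mem_adjoint_domain_of_exists v ⟨w, h1⟩
  have h2 := LinearPMap.adjoint_apply_eq hA.dense_domain ⟨v, hv⟩ h1
  have h3 := (LinearPMap.adjoint A).mem_graph ⟨v, hv⟩
  rw [h2] at h3
  have h4 := LinearPMap.isSelfAdjoint_def.mp hA
  exact h4 ▸ h3

end Graphs

/-! ### The free Hamiltonian on product vectors -/

section FreeHamiltonian

variable {HS HE : Type*} [NormedAddCommGroup HS] [InnerProductSpace ℂ HS] [CompleteSpace HS]
  [NormedAddCommGroup HE] [InnerProductSpace ℂ HE] [CompleteSpace HE]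
  {hamS : HS →ₗ.[ℂ] HS} {hamE : HE →ₗ.[ℂ] HE}

open ContinuousLinearMap (adjoint adjoint_inner_left adjoint_inner_right)

/-- The graph of the free Hamiltonian. -/
def freeGraph (hamS : HS →ₗ.[ℂ] HS) (hamE : HE →ₗ.[ℂ] HE) :
    Submodule ℂ (HTensor HS HE × HTensor HS HE) :=
  (Submodule.span ℂ (Set.range fun p : hamS.domain × hamE.domain =>
    ((tmul (p.1 : HS) (p.2 : HE), tmul (hamS p.1) (p.2 : HE) + tmul (p.1 : HS) (hamE p.2)) :
      HTensor HS HE × HTensor HS HE))).topologicalClosure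

/-- The identity is linear and closed in `(x, y)`, so it need only be checked on the generators of
the graph. -/
theorem freeGraph_inner (hS : IsSelfAdjoint hamS) (hE : IsSelfAdjoint hamE)
    {x y : HTensor HS HE} (h : (x, y) ∈ freeGraph hamS hamE) {s s' : HS} {e e' : HE}
    (hs : (s, s') ∈ hamS.graph) (he : (e, e') ∈ hamE.graph) :
    ⟪y, tmul s e⟫_ℂ = ⟪x, tmul s' e + tmul s e'⟫_ℂ := by
  have hc : IsClosed {p : HTensor HS HE × HTensor HS HE |
      ⟪p.2, tmul s e⟫_ℂ = ⟪p.1, tmul s' e + tmul s e'⟫_ℂ} :=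
    isClosed_eq (continuous_snd.inner continuous_const) (continuous_fst.inner continuous_const)
  refine hc.closure_subset_iff.mpr (fun p hp => ?_) h
  induction hp using Submodule.span_induction with
  | mem p hp =>
    obtain ⟨⟨t, f⟩, rfl⟩ := hp
    have h1 := graph_symmetric hS (hamS.mem_graph t) hs
    have h2 := graph_symmetric hE (hamE.mem_graph f) he
    simp only [Set.mem_ofPred_eq, inner_add_left, inner_add_right, inner_tmul, h1, h2]
  | zero => simp
  | add p q _ _ hp hq =>
    simp only [Set.mem_ofPred_eq, Prod.fst_add, Prod.snd_add, inner_add_left] at hp hq ⊢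
    rw [hp, hq]
  | smul c p _ hp =>
    simp only [Set.mem_ofPred_eq, Prod.smul_fst, Prod.smul_snd, inner_smul_left] at hp ⊢
    rw [hp]

theorem eq_of_inner_tmul_of_dense {f g : HS → HE → ℂ} (hS : Dense (hamS.domain : Set HS))
    (hE : Dense (hamE.domain : Set HE)) (hf : ∀ e, Continuous fun s => f s e)
    (hf' : ∀ s, Continuous fun e => f s e) (hg : ∀ e, Continuous fun s => g s e)
    (hg' : ∀ s, Continuous fun e => g s e)
    (h : ∀ s ∈ hamS.domain, ∀ e ∈ hamE.domain, f s e = g s e) (s : HS) (e : HE) :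
    f s e = g s e := by
  have h1 (e) (he : e ∈ hamE.domain) : (fun s => f s e) = fun s => g s e :=
    Continuous.ext_on hS (hf e) (hg e) fun s hs => h s hs e he
  have h2 : (fun e => f s e) = fun e => g s e :=
    Continuous.ext_on hE (hf' s) (hg' s) fun e he => congrFun (h1 e he) s
  exact congrFun h2 e

theorem graph_freeHamiltonian (hS : IsSelfAdjoint hamS) (hE : IsSelfAdjoint hamE) :
    (freeHamiltonian hamS hamE).graph = freeGraph hamS hamE := by
  refine Submodule.toLinearPMap_graph_eq _ ?_
  rintro ⟨x, y⟩ h rfl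
  refine eq_zero_of_inner_tmul fun s e => ?_
  refine eq_of_inner_tmul_of_dense (f := fun s e => ⟪y, tmul s e⟫_ℂ) (g := fun _ _ => 0)
    hS.dense_domain hE.dense_domain (fun e => (innerSL ℂ y ∘L tmulR HS e).continuous)
    (fun s => (innerSL ℂ y ∘L tmulL HE s).continuous) (fun _ => continuous_const)
    (fun _ => continuous_const) (fun s hs e he => ?_) s e
  have := freeGraph_inner hS hE h (hamS.mem_graph ⟨s, hs⟩) (hamE.mem_graph ⟨e, he⟩)
  simpa using this

theorem isClosed_freeHamiltonian (hS : IsSelfAdjoint hamS) (hE : IsSelfAdjoint hamE) :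
    (freeHamiltonian hamS hamE).IsClosed := by
  rw [LinearPMap.IsClosed, graph_freeHamiltonian hS hE]
  exact Submodule.isClosed_topologicalClosure _

theorem exists_graph_of_freeHamiltonian (hS : IsSelfAdjoint hamS) (hE : IsSelfAdjoint hamE)
    {ψ : HS} {α : HE} {y : HTensor HS HE} (hα : α ≠ 0)
    (h : (tmul ψ α, y) ∈ (freeHamiltonian hamS hamE).graph) : ∃ φ, (ψ, φ) ∈ hamS.graph := by
  rw [graph_freeHamiltonian hS hE] at h
  obtain ⟨e, he, hne⟩ : ∃ e ∈ hamE.domain, ⟪α, e⟫_ℂ ≠ 0 := by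
    by_contra! hcon
    have : (fun e => ⟪α, e⟫_ℂ) = fun _ => (0 : ℂ) :=
      Continuous.ext_on hE.dense_domain (innerSL ℂ α).continuous continuous_const hcon
    exact hα (inner_self_eq_zero.mp (congrFun this α))
  -- Solve `⟨y, s ⊗ e⟩ = ⟨ψ, s'⟩⟨α, e⟩ + ⟨ψ, s⟩⟨α, hamE e⟩` for `⟨ψ, s'⟩`, with `s' = hamS s`: it is
  -- a bounded functional of `s`, so `ψ` lies in the domain of the self-adjoint `hamS`.
  refine ⟨(starRingEnd ℂ) (⟪α, e⟫_ℂ)⁻¹ • (adjoint (tmulR HS e) y -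
    (starRingEnd ℂ) ⟪α, hamE ⟨e, he⟩⟫_ℂ • ψ), mem_graph_of_inner hS fun s s' hs => ?_⟩
  have h1 := freeGraph_inner hS hE h hs (hamE.mem_graph ⟨e, he⟩)
  rw [inner_add_right, inner_tmul, inner_tmul] at h1
  rw [inner_smul_left, inner_sub_left, inner_smul_left, adjoint_inner_left, tmulR_apply, h1,
    Complex.conj_conj, Complex.conj_conj]
  field_simp
  ring

/-- Formally `y = φ ⊗ α + ψ ⊗ hamE α`, and `Q` kills the second term. Since `α` is not assumed to be
in the domain of `hamE`, the argument pairs with `s ⊗ e` and puts `hamE` on `e`. -/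
theorem opTensor_freeHamiltonian (hS : IsSelfAdjoint hamS) (hE : IsSelfAdjoint hamE)
    {ψ φ : HS} (hψ : ‖ψ‖ = 1) {α : HE} {y : HTensor HS HE} (hφ : (ψ, φ) ∈ hamS.graph)
    (h : (tmul ψ α, y) ∈ (freeHamiltonian hamS hamE).graph) :
    opTensor (1 - proj ψ) 1 y = tmul ((1 - proj ψ) φ) α := by
  rw [graph_freeHamiltonian hS hE] at h
  have key (e) (he : e ∈ hamE.domain) (s : HS) :
      ⟪y, tmul s e⟫_ℂ = ⟪φ, s⟫_ℂ * ⟪α, e⟫_ℂ + ⟪ψ, s⟫_ℂ * ⟪α, hamE ⟨e, he⟩⟫_ℂ := by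
    have : (fun s => ⟪y, tmul s e⟫_ℂ) =
        fun s => ⟪φ, s⟫_ℂ * ⟪α, e⟫_ℂ + ⟪ψ, s⟫_ℂ * ⟪α, hamE ⟨e, he⟩⟫_ℂ := by
      refine Continuous.ext_on hS.dense_domain (innerSL ℂ y ∘L tmulR HS e).continuous
        (((innerSL ℂ φ).continuous.mul continuous_const).add
          ((innerSL ℂ ψ).continuous.mul continuous_const)) fun s hs => ?_
      have h1 := freeGraph_inner hS hE h (hamS.mem_graph ⟨s, hs⟩) (hamE.mem_graph ⟨e, he⟩)
      rw [inner_add_right, inner_tmul, inner_tmul] at h1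
      rw [h1, graph_symmetric hS hφ (hamS.mem_graph ⟨s, hs⟩)]
    exact congrFun this s
  have hψ1 : ⟪ψ, ψ⟫_ℂ = 1 := by rw [inner_self_eq_ofReal, hψ]; simp
  rw [← sub_eq_zero]
  refine eq_zero_of_inner_tmul fun s e => ?_
  have : (fun e => ⟪opTensor (1 - proj ψ) 1 y - tmul ((1 - proj ψ) φ) α, tmul s e⟫_ℂ) =
      fun _ => (0 : ℂ) := by
    refine Continuous.ext_on hE.dense_domain ((innerSL ℂ _ ∘L tmulL HE s).continuous)
      continuous_const fun e he => ?_
    rw [inner_sub_left, opTensor_one_sub_proj, inner_sub_left, inner_tmul, inner_tmul, key e he,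
      adjoint_inner_left, tmulL_apply, key e he]
    simp only [sub_apply, one_apply_eq_self, proj, InnerProductSpace.rankOne_apply,
      inner_sub_left, inner_smul_left, inner_conj_symm, hψ1]
    ring
  exact congrFun this e

end FreeHamiltonian

/-! ### Roots of the environment state and the covariance matrices -/

section Covariances

variable {H K : Type*} [NormedAddCommGroup H] [InnerProductSpace ℂ H] [CompleteSpace H]
  [NormedAddCommGroup K] [InnerProductSpace ℂ K] [CompleteSpace K] {ι : Type*}

open ContinuousLinearMap (adjoint adjoint_inner_left adjoint_inner_right)

section Root

variable {E : H →ₗ.[ℂ] H} (hE : IsSelfAdjoint E) {a : K →L[ℂ] H} {G T : H →L[ℂ] H}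
  (hG : ∀ x, ((a ∘L adjoint a) x, G x) ∈ E.graph)
  (hT : IsBoundedExtension (comp (comp E (bdd (a ∘L adjoint a))) E) T)

include hG hT

theorem sandwich_apply {x x' : H} (hx : (x, x') ∈ E.graph) : T x = G x' :=
  hT.apply_eq (mem_graph_comp.mpr ⟨x', hx, mem_graph_comp_bdd.mpr (hG x')⟩)

include hE

/-- `‖a* E x‖² = ⟨E x, a a* E x⟩ = ⟨x, T x⟩`; so `a* E` is bounded, which places the range of `a` in
the domain of `E* = E`. -/
theorem sq_norm_adjoint_le {x x' : H} (hx : (x, x') ∈ E.graph) :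
    ‖adjoint a x'‖ ^ 2 ≤ ‖T‖ * ‖x‖ ^ 2 := by
  have h1 : ⟪adjoint a x', adjoint a x'⟫_ℂ = ⟪x, T x⟫_ℂ := by
    rw [adjoint_inner_left, sandwich_apply hG hT hx]
    exact graph_symmetric hE hx (hG x')
  rw [← inner_self_eq_norm_sq (𝕜 := ℂ), h1]
  refine (Complex.re_le_norm _).trans ((norm_inner_le_norm _ _).trans ?_)
  nlinarith [T.le_opNorm x, norm_nonneg x]

/-- If `E a a* E` is bounded, then `a` maps into the domain of `E`. -/
theorem range_subset_domain (y : K) : a y ∈ E.domain := by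
  have hsa := LinearPMap.isSelfAdjoint_def.mp hE
  suffices h : a y ∈ (LinearPMap.adjoint E).domain by rwa [hsa] at h
  rw [LinearPMap.mem_adjoint_domain_iff]
  refine AddMonoidHomClass.continuous_of_bound ((innerₛₗ ℂ (a y)).comp E.toFun)
    (‖y‖ * Real.sqrt ‖T‖) fun x => ?_
  have h1 : ((innerₛₗ ℂ (a y)).comp E.toFun) x = ⟪y, adjoint a (E x)⟫_ℂ := by
    rw [adjoint_inner_right]
    rfl
  rw [h1, mul_assoc]
  refine (norm_inner_le_norm _ _).trans ?_
  gcongr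
  refine le_of_sq_le_sq ?_ (by positivity)
  rw [mul_pow, Real.sq_sqrt (norm_nonneg _)]
  exact sq_norm_adjoint_le hE hG hT (E.mem_graph x)

theorem exists_graph_root : ∃ F : K →L[ℂ] H, ∀ y, (a y, F y) ∈ E.graph := by
  let F₀ : K →ₗ[ℂ] H := E.toFun ∘ₗ
    LinearMap.codRestrict E.domain a.toLinearMap (range_subset_domain hE hG hT)
  have h0 (y : K) : (a y, F₀ y) ∈ E.graph := E.mem_graph ⟨a y, range_subset_domain hE hG hT y⟩
  have hcl : IsClosed (F₀.graph : Set (K × H)) := by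
    have h1 : (F₀.graph : Set (K × H)) = (fun p : K × H => (a p.1, p.2)) ⁻¹' E.graph := by
      ext ⟨y, z⟩
      simp only [SetLike.mem_coe, LinearMap.mem_graph_iff, Set.mem_preimage]
      constructor
      · rintro rfl
        exact h0 y
      · exact fun h => graph_functional h (h0 y)
    rw [h1]
    exact IsClosed.preimage ((a.continuous.comp continuous_fst).prodMk continuous_snd) hE.isClosed
  exact ⟨⟨F₀, F₀.continuous_of_isClosed_graph hcl⟩, h0⟩

/-- `F*` extends `a* E`, hence `F F* = T` on a dense domain, and the finite trace of `T` is the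
squared Hilbert–Schmidt norm of `F*`. -/
theorem isHS_root (hTr : IsTraceClass T) {F : K →L[ℂ] H} (hF : ∀ y, (a y, F y) ∈ E.graph) :
    IsHS F := by
  have h1 {x x' : H} (hx : (x, x') ∈ E.graph) : adjoint F x = adjoint a x' := by
    refine ext_inner_right ℂ fun y => ?_
    rw [adjoint_inner_left, adjoint_inner_left]
    exact (graph_symmetric hE hx (hF y)).symm
  have h2 : F ∘L adjoint F = T := by
    refine DFunLike.coe_injective (Continuous.ext_on hE.dense_domain
      (F ∘L adjoint F).continuous T.continuous fun x hx => ?_)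
    have hx' := E.mem_graph ⟨x, hx⟩
    rw [ContinuousLinearMap.comp_apply, h1 hx', sandwich_apply hG hT hx']
    exact graph_functional (hF _) (hG _)
  have h3 : IsHS (adjoint F) := by
    have h4 := (Complex.hasSum_re (hTr.hasSum (stdBasis H))).summable
    refine Summable.congr h4 fun i => ?_
    rw [← h2, ContinuousLinearMap.comp_apply, ← adjoint_inner_left, inner_self_eq_ofReal,
      Complex.ofReal_re]
  simpa using h3.adjoint

end Root

theorem traceOp_eq {A : H →ₗ.[ℂ] H} {T : H →L[ℂ] H} (h : IsBoundedExtension A T) :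
    traceOp A = trace T := by
  rw [traceOp, extend_eq h]

theorem traceOp_comp_bdd {E : H →ₗ.[ℂ] H} {a F : K →L[ℂ] H}
    (hF : ∀ y, (a y, F y) ∈ E.graph) :
    traceOp (comp E (bdd (a ∘L adjoint a))) = trace (F ∘L adjoint a) :=
  traceOp_eq (isBoundedExtension_of_graph fun x => mem_graph_comp_bdd.mpr (hF (adjoint a x)))

/-- The graph of `E` contains all `(E' a a* x, E E' a a* x)`. -/
theorem graph_comp_comp_bdd {E E' : H →ₗ.[ℂ] H} (hE : E.IsClosed) {a F' : K →L[ℂ] H}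
    (hF' : ∀ y, (a y, F' y) ∈ E'.graph) {L : H →L[ℂ] H}
    (hL : IsBoundedExtension (comp E (comp E' (bdd (a ∘L adjoint a)))) L) (x : H) :
    ((F' ∘L adjoint a) x, L x) ∈ E.graph := by
  have hG (x) : ((a ∘L adjoint a) x, (F' ∘L adjoint a) x) ∈ E'.graph := hF' (adjoint a x)
  refine graph_of_dense hE hL.1 (fun x hx => ?_) x
  have h1 := (comp E (comp E' (bdd (a ∘L adjoint a)))).mem_graph ⟨x, hx⟩
  rw [← hL.2, mem_graph_comp] at h1
  obtain ⟨y, hy, hy'⟩ := h1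
  rw [mem_graph_comp_bdd] at hy
  rwa [graph_functional hy (hG x)] at hy'

/-- `F* F'` factors through `H`, whereas the definition of trace class wants both factors on `K`;
the isometry `J` embeds `H` in `K`. -/
theorem isTraceClass_adjoint_comp {F F' : K →L[ℂ] H} (hF : IsHS F) (hF' : IsHS F')
    {J : H →L[ℂ] K} (hJ : adjoint J ∘L J = 1) : IsTraceClass (adjoint F ∘L F') := by
  have h : adjoint F ∘L F' = (adjoint F ∘L adjoint J) ∘L (J ∘L F') := by
    ext x
    exact congr(adjoint F ($hJ (F' x))).symm
  rw [h]
  exact isTraceClass_comp (hF.adjoint.comp_right _) (hF'.comp_left J)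

/-- `tr (E E' a a*) = ⟨E a, E' a⟩` for the Hilbert-Schmidt inner product. -/
theorem traceOp_comp_comp_bdd {E E' : H →ₗ.[ℂ] H} (hE : IsSelfAdjoint E) {a F F' : K →L[ℂ] H}
    (ha : IsHS a) (hF : ∀ y, (a y, F y) ∈ E.graph) (hF' : ∀ y, (a y, F' y) ∈ E'.graph)
    (hFs : IsHS F) (hFs' : IsHS F') {J : H →L[ℂ] K} (hJ : adjoint J ∘L J = 1)
    (h : IsTraceClassOp (comp E (comp E' (bdd (a ∘L adjoint a))))) :
    traceOp (comp E (comp E' (bdd (a ∘L adjoint a)))) = trace (adjoint F ∘L F') := by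
  obtain ⟨L, hL, hLtr⟩ := h
  have hLg := graph_comp_comp_bdd hE.isClosed hF' hL
  rw [traceOp_eq hL]
  -- The intertwining relation is `a* (E E' a a*) = (E a)* E' a a* = (F* F') a*`.
  refine trace_eq_of_intertwine ha hLtr (isTraceClass_adjoint_comp hFs hFs' hJ) ?_ ?_ ?_
  · ext x
    refine ext_inner_right ℂ fun y => ?_
    have h1 := graph_symmetric hE (hLg x) (hF y)
    rw [ContinuousLinearMap.comp_apply, ContinuousLinearMap.comp_apply,
      ContinuousLinearMap.comp_apply, adjoint_inner_left, adjoint_inner_left]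
    exact h1
  · intro x hx
    have := hLg x
    rw [ContinuousLinearMap.comp_apply, hx, map_zero] at this
    exact graph_zero this
  · intro y hy
    have := hF' y
    rw [hy] at this
    rw [ContinuousLinearMap.comp_apply, graph_zero this, map_zero]

/-- Both operators have rank at most one, with traces `⟨σ j, σ l⟩` and `⟨ψ, σ j⟩⟨ψ, σ l⟩`; the
difference is the Gram matrix of the components orthogonal to `ψ`. -/
theorem covS_apply {m : ℕ} {S : Fin m → H →ₗ.[ℂ] H} (hS : ∀ j, IsSelfAdjoint (S j)) {ψ : H}
    (hψ : ‖ψ‖ = 1) (hreg : SystemRegular S ψ) {σ : Fin m → H}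
    (hσ : ∀ j, (ψ, σ j) ∈ (S j).graph) (j l : Fin m) :
    covS S (proj ψ) j l = ⟪(1 - proj ψ) (σ j), (1 - proj ψ) (σ l)⟫_ℂ := by
  obtain ⟨τ, hτ⟩ : ∃ τ, (σ l, τ) ∈ (S j).graph := by
    obtain ⟨τ, hτ⟩ := LinearPMap.mem_domain_iff.mp (hreg.2 j l)
    obtain ⟨y, hy, hy'⟩ := mem_graph_comp.mp hτ
    rw [graph_functional hy (hσ l)] at hy'
    exact ⟨τ, hy'⟩
  have hψ1 : ⟪ψ, ψ⟫_ℂ = 1 := by rw [inner_self_eq_ofReal, hψ]; simp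
  have hP (x : H) : proj ψ x = ⟪ψ, x⟫_ℂ • ψ := by simp [proj]
  have hg (k : Fin m) (x : H) : (x, ⟪ψ, x⟫_ℂ • σ k) ∈ (comp (S k) (bdd (proj ψ))).graph := by
    rw [mem_graph_comp_bdd, hP]
    exact (S k).graph.smul_mem ⟪ψ, x⟫_ℂ (hσ k)
  have h1 : traceOp (comp (S j) (comp (S l) (bdd (proj ψ)))) = ⟪ψ, τ⟫_ℂ := by
    rw [← trace_rankOne]
    refine traceOp_eq (isBoundedExtension_of_graph fun x => mem_graph_comp.mpr ⟨_, hg l x, ?_⟩)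
    rw [InnerProductSpace.rankOne_apply]
    exact (S j).graph.smul_mem ⟪ψ, x⟫_ℂ hτ
  have h2 : traceOp (comp (comp (S j) (bdd (proj ψ))) (comp (S l) (bdd (proj ψ)))) =
      ⟪ψ, ⟪ψ, σ l⟫_ℂ • σ j⟫_ℂ := by
    rw [← trace_rankOne]
    refine traceOp_eq (isBoundedExtension_of_graph fun x => mem_graph_comp.mpr ⟨_, hg l x, ?_⟩)
    have := hg j (⟪ψ, x⟫_ℂ • σ l)
    rwa [inner_smul_right, mul_smul] at this
  rw [covS, Matrix.of_apply, h1, h2, ← graph_symmetric (hS j) (hσ j) hτ]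
  have h3 : ⟪σ j, ψ⟫_ℂ = ⟪ψ, σ j⟫_ℂ := graph_symmetric (hS j) (hσ j) (hσ j)
  simp only [sub_apply, one_apply_eq_self, hP, inner_sub_left, inner_sub_right, inner_smul_left,
    inner_smul_right, hψ1, inner_conj_symm, h3]
  ring

end Covariances

/-! ### The interaction applied to the root of the initial state -/

section Interaction

open ContinuousLinearMap (adjoint adjoint_inner_left adjoint_inner_right)

variable {H : Type*} [NormedAddCommGroup H] [InnerProductSpace ℂ H] [CompleteSpace H]

/-- If `D = V A`, then `D D*` is the bounded extension of `V A A* V`. -/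
theorem isBoundedExtension_sandwich {V : H →ₗ.[ℂ] H} (hV : IsSelfAdjoint V) {A D : H →L[ℂ] H}
    (hD : ∀ y, (A y, D y) ∈ V.graph) :
    IsBoundedExtension (comp V (comp (bdd (A ∘L adjoint A)) V)) (D ∘L adjoint D) := by
  have h1 {x x' : H} (hx : (x, x') ∈ V.graph) :
      (x, D (adjoint D x)) ∈ (comp V (comp (bdd (A ∘L adjoint A)) V)).graph := by
    have h2 : adjoint D x = adjoint A x' := by
      refine ext_inner_right ℂ fun y => ?_
      rw [adjoint_inner_left, adjoint_inner_left]
      exact (graph_symmetric hV hx (hD y)).symm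
    rw [h2]
    exact mem_graph_comp.mpr ⟨_, mem_graph_comp.mpr ⟨x', hx, mem_graph_bdd.mpr rfl⟩,
      hD (adjoint A x')⟩
  refine ⟨hV.dense_domain.mono fun x hx =>
    LinearPMap.mem_domain_of_mem_graph (h1 (V.mem_graph ⟨x, hx⟩)), fun x => ?_⟩
  obtain ⟨y, hy, -⟩ := mem_graph_comp.mp ((comp V (comp (bdd (A ∘L adjoint A)) V)).mem_graph x)
  obtain ⟨z, hz, -⟩ := mem_graph_comp.mp hy
  exact graph_functional (h1 hz) (LinearPMap.mem_graph _ x)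

end Interaction

section Factorization

variable {H : Type*} [NormedAddCommGroup H] [InnerProductSpace ℂ H] [CompleteSpace H]
  {HS HE : Type*} [NormedAddCommGroup HS] [InnerProductSpace ℂ HS] [CompleteSpace HS]
  [NormedAddCommGroup HE] [InnerProductSpace ℂ HE] [CompleteSpace HE]

open ContinuousLinearMap (adjoint adjoint_inner_left adjoint_inner_right)

theorem StateFactorization.eq_comp_adjoint {ρ : H →L[ℂ] H} {K₀ : H →ₗ.[ℂ] H} {R K₁ : H →L[ℂ] H}
    (h : StateFactorization ρ K₀ R K₁) : IsHS (R ∘L K₁) ∧ ρ = (R ∘L K₁) ∘L adjoint (R ∘L K₁) := by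
  obtain ⟨hK, -, ⟨hR, -⟩, hHS, hK₁, rfl⟩ := h
  refine ⟨(isHilbertSchmidt_iff.mp hHS).comp_right K₁, ?_⟩
  have hRa : adjoint R = R := by
    ext x
    refine ext_inner_right ℂ fun y => ?_
    rw [adjoint_inner_left]
    exact graph_symmetric hK (hR x) (hR y)
  rw [ContinuousLinearMap.adjoint_comp, hRa, hK₁.adjoint_eq]
  rfl

theorem product_factorization {ψ : HS} (hψ : ‖ψ‖ = 1) {ρE : HE →L[ℂ] HE}
    {A : HTensor HS HE →L[ℂ] HTensor HS HE} (h : opTensor (proj ψ) ρE = A ∘L adjoint A) :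
    (∀ x, A x = tmul ψ (adjoint (tmulL HE ψ) (A x))) ∧
      (adjoint (tmulL HE ψ) ∘L A) ∘L adjoint (adjoint (tmulL HE ψ) ∘L A) = ρE := by
  have hJ : adjoint (tmulL HE ψ) ∘L tmulL HE ψ = 1 := by
    ext x
    rw [ContinuousLinearMap.comp_apply, tmulL_apply, adjoint_tmulL_tmul, inner_self_eq_ofReal, hψ]
    simp
  have hJ' (x : HE) : adjoint (tmulL HE ψ) (tmul ψ x) = x := congr($hJ x)
  rw [proj, opTensor_rankOne] at h
  constructor
  · intro x
    -- `‖A* w‖² = ⟨w, A A* w⟩`, and the product state annihilates the complement of `ψ ⊗ HE`;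
    -- dually, `A` has range in `ψ ⊗ HE`.
    have hQ (z : HTensor HS HE) : adjoint A (z - tmulL HE ψ (adjoint (tmulL HE ψ) z)) = 0 := by
      rw [← norm_eq_zero, ← sq_eq_zero_iff, ← inner_self_eq_norm_sq (𝕜 := ℂ), adjoint_inner_left,
        ← ContinuousLinearMap.comp_apply A, ← h]
      have h0 : tmul ψ (0 : HE) = 0 := map_zero (tmulL HE ψ)
      simp [hJ', h0]
    rw [← sub_eq_zero]
    refine ext_inner_right ℂ fun z => ?_
    have h1 : ⟪A x - tmul ψ (adjoint (tmulL HE ψ) (A x)), z⟫_ℂ =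
        ⟪x, adjoint A (z - tmulL HE ψ (adjoint (tmulL HE ψ) z))⟫_ℂ := by
      rw [adjoint_inner_right A, inner_sub_left, inner_sub_right, ← tmulL_apply,
        ← adjoint_inner_right (tmulL HE ψ), ← adjoint_inner_left (tmulL HE ψ)]
    rw [h1, hQ, inner_zero_right, inner_zero_left]
  · rw [ContinuousLinearMap.adjoint_comp, ContinuousLinearMap.adjoint_adjoint,
      ContinuousLinearMap.comp_assoc, ← ContinuousLinearMap.comp_assoc A, ← h]
    ext x
    simp [hJ']

end Factorization

section InteractionOp

open ContinuousLinearMap (adjoint adjoint_inner_left adjoint_inner_right)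

variable {K HS HE : Type*} [NormedAddCommGroup K] [InnerProductSpace ℂ K] [CompleteSpace K]
  [NormedAddCommGroup HS] [InnerProductSpace ℂ HS] [CompleteSpace HS]
  [NormedAddCommGroup HE] [InnerProductSpace ℂ HE] [CompleteSpace HE] {m : ℕ} {ι : Type*}

/-- The operator `y ↦ ∑ⱼ σⱼ ⊗ Fⱼ y`. -/
def sumTmul (σ : Fin m → HS) (F : Fin m → K →L[ℂ] HE) : K →L[ℂ] HTensor HS HE :=
  ∑ j, tmulL HE (σ j) ∘L F j

theorem sumTmul_apply (σ : Fin m → HS) (F : Fin m → K →L[ℂ] HE) (y : K) :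
    sumTmul σ F y = ∑ j, tmul (σ j) (F j y) := by
  simp [sumTmul]

theorem isHS_sumTmul (σ : Fin m → HS) {F : Fin m → K →L[ℂ] HE} (hF : ∀ j, IsHS (F j)) :
    IsHS (sumTmul σ F) :=
  IsHS.sum fun j _ => (hF j).comp_left _

theorem opTensor_sumTmul (T : HS →L[ℂ] HS) (σ : Fin m → HS) (F : Fin m → K →L[ℂ] HE) (y : K) :
    opTensor T 1 (sumTmul σ F y) = sumTmul (fun j => T (σ j)) F y := by
  simp [sumTmul_apply, map_sum]

theorem hasSum_inner_tmul_sumTmul (b : HilbertBasis ι ℂ K) (s : HS) (σ : Fin m → HS)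
    {a : K →L[ℂ] HE} {F : Fin m → K →L[ℂ] HE} (ha : IsHS a) (hF : ∀ j, IsHS (F j)) :
    HasSum (fun l => ⟪tmul s (a (b l)), sumTmul σ F (b l)⟫_ℂ)
      (∑ j, ⟪s, σ j⟫_ℂ * trace (F j ∘L adjoint a)) := by
  refine (hasSum_sum fun j _ => (hasSum_inner_of_isHS b ha (hF j)).mul_left ⟪s, σ j⟫_ℂ).congr_fun
    fun l => ?_
  simp [sumTmul_apply, inner_sum, inner_tmul]

theorem hasSum_norm_sumTmul_sq (b : HilbertBasis ι ℂ K) (σ : Fin m → HS)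
    {F : Fin m → K →L[ℂ] HE} (hF : ∀ j, IsHS (F j)) :
    HasSum (fun l => ((‖sumTmul σ F (b l)‖ ^ 2 : ℝ) : ℂ))
      (∑ j, ∑ k, ⟪σ j, σ k⟫_ℂ * trace (adjoint (F j) ∘L F k)) := by
  have h (j k : Fin m) := (hasSum_inner_of_isHS b (hF j) (hF k)).mul_left ⟪σ j, σ k⟫_ℂ
  simp only [fun j k => trace_comp_comm (hF k) (hF j).adjoint] at h
  refine (hasSum_sum fun j _ => hasSum_sum fun k _ => h j k).congr_fun fun l => ?_
  rw [← inner_self_eq_ofReal, sumTmul_apply, sum_inner]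
  simp only [inner_sum, inner_tmul]

theorem IsInteraction.mem_graph {S : Fin m → HS →ₗ.[ℂ] HS} {E : Fin m → HE →ₗ.[ℂ] HE}
    {V : HTensor HS HE →ₗ.[ℂ] HTensor HS HE} (hV : IsInteraction S E V) {ψ : HS} {σ : Fin m → HS}
    (hσ : ∀ j, (ψ, σ j) ∈ (S j).graph) {a : K →L[ℂ] HE} {F : Fin m → K →L[ℂ] HE}
    (hF : ∀ j y, (a y, F j y) ∈ (E j).graph) (y : K) :
    (tmul ψ (a y), sumTmul σ F y) ∈ V.graph := by
  have h := hV ψ (a y) (fun j => LinearPMap.mem_domain_of_mem_graph (hσ j))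
    fun j => LinearPMap.mem_domain_of_mem_graph (hF j y)
  rw [sumTmul_apply]
  convert h using 4 with j
  · exact graph_functional (hσ j) ((S j).mem_graph ⟨ψ, _⟩)
  · exact graph_functional (hF j y) ((E j).mem_graph ⟨a y, _⟩)

theorem EnvironmentRegular.exists_graph {E : Fin m → HE →ₗ.[ℂ] HE} (hsa : ∀ j, IsSelfAdjoint (E j))
    {a : K →L[ℂ] HE} (h : EnvironmentRegular E (a ∘L adjoint a)) :
    ∃ F : Fin m → K →L[ℂ] HE, (∀ j, IsHS (F j)) ∧ ∀ j y, (a y, F j y) ∈ (E j).graph := by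
  have key (j : Fin m) : ∃ F : K →L[ℂ] HE, IsHS F ∧ ∀ y, (a y, F y) ∈ (E j).graph := by
    obtain ⟨⟨G, hG, -⟩, ⟨T, hT, hTr⟩, -⟩ := h j j
    have hG' := graph_comp_bdd_of_closed (hsa j).isClosed hG
    obtain ⟨F, hF⟩ := exists_graph_root (hsa j) hG' hT
    exact ⟨F, isHS_root (hsa j) hG' hT hTr hF, hF⟩
  choose F hF hF' using key
  exact ⟨F, hF, hF'⟩

end InteractionOp

/-! ### Trace of `V ρ V` against the projection, and strict positivity -/

section Projection

open ContinuousLinearMap (adjoint adjoint_inner_left adjoint_inner_right)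

variable {HS HE : Type*} [NormedAddCommGroup HS] [InnerProductSpace ℂ HS] [CompleteSpace HS]
  [NormedAddCommGroup HE] [InnerProductSpace ℂ HE] [CompleteSpace HE] {ι : Type*}

theorem inner_opTensor_one_sub_proj (ψ : HS) (z w : HTensor HS HE) :
    ⟪opTensor (1 - proj ψ) 1 z, w⟫_ℂ = ⟪z, opTensor (1 - proj ψ) 1 w⟫_ℂ := by
  rw [opTensor_one_sub_proj, opTensor_one_sub_proj, inner_sub_left, inner_sub_right,
    ← tmulL_apply, ← tmulL_apply, ← adjoint_inner_right (tmulL HE ψ),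
    ← adjoint_inner_left (tmulL HE ψ)]

theorem inner_opTensor_one_sub_proj_self {ψ : HS} (hψ : ‖ψ‖ = 1) (z : HTensor HS HE) :
    ⟪z, opTensor (1 - proj ψ) 1 z⟫_ℂ = ((‖opTensor (1 - proj ψ) 1 z‖ ^ 2 : ℝ) : ℂ) := by
  rw [norm_opTensor_one_sub_proj_sq hψ, opTensor_one_sub_proj, inner_sub_right, ← tmulL_apply,
    ← adjoint_inner_left (tmulL HE ψ), inner_self_eq_ofReal, inner_self_eq_ofReal]
  push_cast
  rfl

theorem hasSum_trace_comp_opTensor (b : HilbertBasis ι ℂ (HTensor HS HE)) {ψ : HS} (hψ : ‖ψ‖ = 1)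
    {D : HTensor HS HE →L[ℂ] HTensor HS HE} (hD : IsHS D) :
    HasSum (fun l => ((‖opTensor (1 - proj ψ) 1 (D (b l))‖ ^ 2 : ℝ) : ℂ))
      (trace ((D ∘L adjoint D) ∘L opTensor (1 - proj ψ) 1)) := by
  rw [(isTraceClass_comp hD hD.adjoint).trace_comp_comm]
  refine (hasSum_inner_of_isHS b hD (hD.comp_left (opTensor (1 - proj ψ) 1))).congr_fun fun l => ?_
  exact (inner_opTensor_one_sub_proj_self hψ _).symm

/-- If the sum vanished, `Q D` would vanish on a basis, hence identically, and so would `⟨Q u, D D*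
v⟩ = ⟨u, Q D D* v⟩`. -/
theorem tsum_pos_of_inner_ne_zero (b : HilbertBasis ι ℂ (HTensor HS HE)) {ψ : HS}
    {D : HTensor HS HE →L[ℂ] HTensor HS HE} (hD : IsHS D) {u v : HTensor HS HE}
    (h : ⟪opTensor (1 - proj ψ) 1 u, (D ∘L adjoint D) v⟫_ℂ ≠ 0) :
    0 < ∑' l, ‖opTensor (1 - proj ψ) 1 (D (b l))‖ ^ 2 := by
  set Q : HTensor HS HE →L[ℂ] HTensor HS HE := opTensor (1 - proj ψ) 1 with hQ
  have hs : Summable fun l => ‖Q (D (b l))‖ ^ 2 := (hD.comp_left Q).summable b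
  by_contra hcon
  refine h ?_
  have h0 : HasSum (fun l => ‖Q (D (b l))‖ ^ 2) 0 := by
    have := hs.hasSum
    rwa [le_antisymm (not_lt.mp hcon) (tsum_nonneg fun _ => by positivity)] at this
  have h1 (l) : Q (D (b l)) = 0 := by
    have := congrFun ((hasSum_zero_iff_of_nonneg fun _ => by positivity).mp h0) l
    simpa using this
  have h2 : Q ∘L D = 0 := by
    refine ContinuousLinearMap.ext fun x => ?_
    have := ((b.hasSum_repr x).mapL (Q ∘L D))
    refine this.unique ?_
    simp [h1]
  rw [inner_opTensor_one_sub_proj]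
  have h3 : Q (D (adjoint D v)) = 0 := congr($h2 (adjoint D v))
  rw [ContinuousLinearMap.comp_apply, h3, inner_zero_right]

end Projection

open Filter Topology in
theorem exists_lt_of_deriv_deriv_neg {p : ℝ → ℝ} {x : ℝ} (hp : ContDiff ℝ 2 p)
    (h1 : deriv p x = 0) (h2 : deriv (deriv p) x < 0) :
    ∃ ε > 0, ∀ t, 0 < t → t < ε → p (x + t) < p x := by
  have hd : ContDiff ℝ 1 (deriv p) := by
    have : ContDiff ℝ (1 + 1) p := by simpa [one_add_one_eq_two] using hp
    exact (contDiff_succ_iff_deriv.mp this).2.2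
  have hd' : HasDerivAt (deriv p) (deriv (deriv p) x) x :=
    (hd.differentiable (by norm_num) x).hasDerivAt
  have hev := (hasDerivAt_iff_tendsto_slope.mp hd').eventually (gt_mem_nhds h2)
  rw [eventually_nhdsWithin_iff, Metric.eventually_nhds_iff] at hev
  obtain ⟨ε, hε, H⟩ := hev
  refine ⟨ε, hε, fun t ht htε => ?_⟩
  have hanti : StrictAntiOn p (Set.Icc x (x + t)) := by
    refine strictAntiOn_of_deriv_neg (convex_Icc _ _) hp.continuous.continuousOn fun y hy => ?_
    rw [interior_Icc] at hy
    have h3 := H (y := y) (by rw [Real.dist_eq, abs_lt]; constructor <;> linarith [hy.1, hy.2])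
      hy.1.ne'
    rw [slope_def_field, h1, sub_zero] at h3
    have h4 : 0 < y - x := sub_pos.mpr hy.1
    have := (div_lt_iff₀ h4).mp h3
    linarith
  exact hanti (Set.left_mem_Icc.mpr (by linarith)) (Set.right_mem_Icc.mpr (by linarith))
    (by linarith)

/-! ### Assembly of the formulas -/

section Main

open ContinuousLinearMap (adjoint)

variable {HS HE : Type*} [NormedAddCommGroup HS] [InnerProductSpace ℂ HS] [CompleteSpace HS]
  [NormedAddCommGroup HE] [InnerProductSpace ℂ HE] [CompleteSpace HE] {m : ℕ} {ι : Type*}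

theorem StateFactorization.exists_root {ψ : HS} (hψ : ‖ψ‖ = 1) {ρE : HE →L[ℂ] HE}
    (hρE : IsDensityMatrix ρE) {K₀ : HTensor HS HE →ₗ.[ℂ] HTensor HS HE}
    {R K₁ : HTensor HS HE →L[ℂ] HTensor HS HE}
    (h : StateFactorization (opTensor (proj ψ) ρE) K₀ R K₁) :
    ∃ a : HTensor HS HE →L[ℂ] HE, IsHS a ∧ a ∘L adjoint a = ρE ∧
      (∀ x, (R ∘L K₁) x = tmul ψ (a x)) ∧ trace ((R ∘L K₁) ∘L adjoint (R ∘L K₁)) = 1 := by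
  obtain ⟨hA, hAA⟩ := h.eq_comp_adjoint
  obtain ⟨h1, h2⟩ := product_factorization hψ hAA
  have ha := hA.comp_left (adjoint (tmulL HE ψ))
  refine ⟨_, ha, h2, h1, ?_⟩
  have h3 := hasSum_inner_of_isHS (stdBasis (HTensor HS HE)) ha ha
  rw [h2, hρE.2.2] at h3
  refine (hasSum_inner_of_isHS (stdBasis (HTensor HS HE)) hA hA).unique (h3.congr_fun fun l => ?_)
  rw [h1, inner_tmul, inner_self_eq_ofReal ψ, hψ]
  simp

theorem apply_eq_add {H : Type*} [NormedAddCommGroup H] [InnerProductSpace ℂ H]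
    {H₀ V ham : H →ₗ.[ℂ] H} (h : H₀ + V ≤ ham) {x y z w : H} (hx : (x, y) ∈ ham.graph)
    (h₀ : (x, z) ∈ H₀.graph) (hV : (x, w) ∈ V.graph) : y = z + w := by
  obtain ⟨x₀, rfl, rfl⟩ := (LinearPMap.mem_graph_iff _).mp h₀
  have hd : (x₀ : H) ∈ (H₀ + V).domain := ⟨x₀.2, LinearPMap.mem_domain_of_mem_graph hV⟩
  have h1 := LinearPMap.le_graph_of_le h ((H₀ + V).mem_graph ⟨x₀, hd⟩)
  rw [graph_functional hx h1, LinearPMap.add_apply, graph_functional hV (V.mem_graph ⟨x₀, hd.2⟩)]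

/-- For a product state, the part of `H x` orthogonal to the system state is the sum of a
contribution of the free Hamiltonian, which is a product, and one of the interaction. -/
theorem exists_opTensor_ham_eq {hamS : HS →ₗ.[ℂ] HS} {hamE : HE →ₗ.[ℂ] HE}
    {V ham : HTensor HS HE →ₗ.[ℂ] HTensor HS HE} (hamS_sa : IsSelfAdjoint hamS)
    (hamE_sa : IsSelfAdjoint hamE) (ham_eq : freeHamiltonian hamS hamE + V ≤ ham) {ψ : HS}
    (hψ : ‖ψ‖ = 1) {A A₁ B D : HTensor HS HE →L[ℂ] HTensor HS HE} {a : HTensor HS HE →L[ℂ] HE}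
    (ha : ∀ x, A x = tmul ψ (a x)) (h₁ : ∀ x, (A x, A₁ x) ∈ ham.graph)
    (h₀ : ∀ x, (A x, B x) ∈ (freeHamiltonian hamS hamE).graph) (hV : ∀ x, (A x, D x) ∈ V.graph) :
    ∃ η, ⟪ψ, η⟫_ℂ = 0 ∧
      ∀ x, opTensor (1 - proj ψ) 1 (A₁ x) = tmul η (a x) + opTensor (1 - proj ψ) 1 (D x) := by
  have h2 (x) : A₁ x = B x + D x := apply_eq_add ham_eq (h₁ x) (h₀ x) (hV x)
  simp only [ha] at h₀
  by_cases hne : ∃ x, a x ≠ 0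
  · obtain ⟨x, hx⟩ := hne
    obtain ⟨φ, hφ⟩ := exists_graph_of_freeHamiltonian hamS_sa hamE_sa hx (h₀ x)
    refine ⟨(1 - proj ψ) φ, ?_, fun x => ?_⟩
    · simp [proj, hψ]
    · rw [h2, map_add, opTensor_freeHamiltonian hamS_sa hamE_sa hψ hφ (h₀ x)]
  -- If `a = 0` no vector gives access to `hamS ψ`, but then the free part of `ham A` is zero and `η
  -- = 0` serves.
  · push Not at hne
    refine ⟨0, inner_zero_right _, fun x => ?_⟩
    have h3 := h₀ x
    have h4 (s : HS) : tmul s (0 : HE) = 0 := map_zero (tmulL HE s)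
    rw [hne, h4] at h3
    rw [h2, graph_zero h3, hne, h4, zero_add, zero_add]

theorem trace_covS_mul_covE {S : Fin m → HS →ₗ.[ℂ] HS} {E : Fin m → HE →ₗ.[ℂ] HE}
    (S_sa : ∀ j, IsSelfAdjoint (S j)) (E_sa : ∀ j, IsSelfAdjoint (E j)) {ψ : HS} (hψ : ‖ψ‖ = 1)
    (hS : SystemRegular S ψ) {σ : Fin m → HS} (hσ : ∀ j, (ψ, σ j) ∈ (S j).graph)
    {a : HTensor HS HE →L[ℂ] HE} (ha : IsHS a) (hE : EnvironmentRegular E (a ∘L adjoint a))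
    {F : Fin m → HTensor HS HE →L[ℂ] HE} (hF : ∀ j, IsHS (F j))
    (hFg : ∀ j y, (a y, F j y) ∈ (E j).graph) :
    Matrix.trace (covS S (proj ψ) * (covE E (a ∘L adjoint a)).transpose) =
      ∑ j, ∑ k, ⟪(1 - proj ψ) (σ j), (1 - proj ψ) (σ k)⟫_ℂ * trace (adjoint (F j) ∘L F k) := by
  have hJ : adjoint (tmulL HE ψ) ∘L tmulL HE ψ = 1 := by
    ext x
    rw [ContinuousLinearMap.comp_apply, tmulL_apply, adjoint_tmulL_tmul, inner_self_eq_ofReal, hψ]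
    simp
  have hcov (j k) : covE E (a ∘L adjoint a) j k = trace (adjoint (F j) ∘L F k) := by
    rw [covE, Matrix.of_apply]
    exact traceOp_comp_comp_bdd (E_sa j) ha (hFg j) (hFg k) (hF j) (hF k) hJ (hE k j).2.2
  simp only [Matrix.trace, Matrix.diag_apply, Matrix.mul_apply, Matrix.transpose_apply, hcov,
    covS_apply S_sa hψ hS hσ]

end Main

section Purity

open ContinuousLinearMap (adjoint)

variable {HS HE : Type*} [NormedAddCommGroup HS] [InnerProductSpace ℂ HS] [CompleteSpace HS]
  [NormedAddCommGroup HE] [InnerProductSpace ℂ HE] [CompleteSpace HE] {m : ℕ} {ι : Type*}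

/-- The derivatives of the purity for a product state `A A*` with `A x = ψ ⊗ a x`, in terms of the
operator `V A`. -/
theorem purity_of_interaction {hamS : HS →ₗ.[ℂ] HS} {hamE : HE →ₗ.[ℂ] HE}
    {E : Fin m → HE →ₗ.[ℂ] HE} {V ham : HTensor HS HE →ₗ.[ℂ] HTensor HS HE}
    (hamS_sa : IsSelfAdjoint hamS) (hamE_sa : IsSelfAdjoint hamE)
    (ham_sa : IsSelfAdjoint ham) (ham_eq : freeHamiltonian hamS hamE + V ≤ ham)
    {U : ℝ → HTensor HS HE →L[ℂ] HTensor HS HE} (hU : IsPropagator ham U) {ψ : HS} (hψ : ‖ψ‖ = 1)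
    {R K₁ : HTensor HS HE →L[ℂ] HTensor HS HE} {a : HTensor HS HE →L[ℂ] HE} (ha : IsHS a)
    (hA : IsHS (R ∘L K₁)) (hAa : ∀ x, (R ∘L K₁) x = tmul ψ (a x))
    (hA1 : trace ((R ∘L K₁) ∘L adjoint (R ∘L K₁)) = 1)
    (hHam : HamiltonianRegular 2 ham R)
    (hHam₀ : HamiltonianRegular 2 (freeHamiltonian hamS hamE) R)
    {σ : Fin m → HS} {F : Fin m → HTensor HS HE →L[ℂ] HE} (hF : ∀ j, IsHS (F j))
    (hFg : ∀ j y, (a y, F j y) ∈ (E j).graph)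
    (hmean : ∀ j, traceOp (comp (E j) (bdd (a ∘L adjoint a))) = 0)
    (hV : ∀ y, (tmul ψ (a y), sumTmul σ F y) ∈ V.graph)
    (b : HilbertBasis ι ℂ (HTensor HS HE)) {p : ℝ → ℝ}
    (hp : p = fun t => purity (reducedState U ((R ∘L K₁) ∘L adjoint (R ∘L K₁)) t)) :
    ContDiff ℝ 2 p ∧ p 0 = 1 ∧ deriv p 0 = 0 ∧
      deriv (deriv p) 0 = -4 * ∑' l, ‖opTensor (1 - proj ψ) 1 (sumTmul σ F (b l))‖ ^ 2 := by
  obtain ⟨T₁, T₂, hT₁, hT₂, h₁, h₂⟩ := hHam.exists_graph ham_sa.isClosed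
  obtain ⟨B, -, -, -, hB, -⟩ := hHam₀.exists_graph (isClosed_freeHamiltonian hamS_sa hamE_sa)
  obtain ⟨η, hη, hQ⟩ := exists_opTensor_ham_eq hamS_sa hamE_sa ham_eq hψ (A₁ := T₁ ∘L K₁)
    (B := B ∘L K₁) (D := sumTmul σ F) hAa (fun x => h₁ (K₁ x)) (fun x => hB (K₁ x))
    fun x => by rw [hAa]; exact hV x
  refine purity_reducedState_calculus (W := opTensor (1 - proj ψ) 1 ∘L sumTmul σ F) hU
    (fun x y x' y' h h' => graph_symmetric ham_sa h h') hA
    (hT₁.comp_right K₁) (hT₂.comp_right K₁) (fun x => h₁ (K₁ x)) (fun x => h₂ (K₁ x)) hψ hAa hA1 hη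
    ((isHS_sumTmul σ hF).comp_left _) hQ b (fun s => ?_) hp
  have h := hasSum_inner_tmul_sumTmul b s (fun j => (1 - proj ψ) (σ j)) ha hF
  -- The overlaps of `s ⊗ a` with `W` are combinations of the means `tr(Eⱼ ρE)`, all zero by
  -- hypothesis.
  simp only [← fun j => traceOp_comp_bdd (hFg j), hmean, mul_zero, Finset.sum_const_zero] at h
  simpa only [ContinuousLinearMap.comp_apply, opTensor_sumTmul] using h

/-- The reduced state is mixed as long as its purity is less than one. -/
theorem isMixedState_reducedState {ham : HTensor HS HE →ₗ.[ℂ] HTensor HS HE}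
    {U : ℝ → HTensor HS HE →L[ℂ] HTensor HS HE} (hU : IsPropagator ham U)
    {A : HTensor HS HE →L[ℂ] HTensor HS HE} (hA : IsHS A) (h1 : trace (A ∘L adjoint A) = 1)
    {t : ℝ} (ht : purity (reducedState U (A ∘L adjoint A) t) < 1) :
    IsMixedState (reducedState U (A ∘L adjoint A) t) :=
  ⟨isDensityMatrix_reducedState hU hA h1 t, fun h => ht.ne h.purity_eq_one⟩

end Purity

end OpenQuantum

end

theorem mainTheorem6
    {HS : Type*} [NormedAddCommGroup HS] [InnerProductSpace ℂ HS] [CompleteSpace HS]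
    {HE : Type*} [NormedAddCommGroup HE] [InnerProductSpace ℂ HE] [CompleteSpace HE]
    {m : ℕ}
    -- free Hamiltonians, coupling operators, interaction and total Hamiltonian
    (hamS : HS →ₗ.[ℂ] HS) (hamE : HE →ₗ.[ℂ] HE)
    (S : Fin m → HS →ₗ.[ℂ] HS) (E : Fin m → HE →ₗ.[ℂ] HE)
    (V ham : OpenQuantum.HTensor HS HE →ₗ.[ℂ] OpenQuantum.HTensor HS HE)
    (hamS_sa : IsSelfAdjoint hamS) (hamE_sa : IsSelfAdjoint hamE)
    (S_sa : ∀ j, IsSelfAdjoint (S j)) (E_sa : ∀ j, IsSelfAdjoint (E j))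
    (V_sa : IsSelfAdjoint V) (V_eq : OpenQuantum.IsInteraction S E V)
    (ham_sa : IsSelfAdjoint ham) (ham_eq : OpenQuantum.freeHamiltonian hamS hamE + V ≤ ham)
    -- the evolution of the total system
    (U : ℝ → OpenQuantum.HTensor HS HE →L[ℂ] OpenQuantum.HTensor HS HE)
    (hU : OpenQuantum.IsPropagator ham U)
    -- the initial states
    (ψ : HS) (hψ : ‖ψ‖ = 1)
    (ρS : HS →L[ℂ] HS) (hρS : ρS = OpenQuantum.proj ψ)
    (ρE : HE →L[ℂ] HE) (hρE : OpenQuantum.IsDensityMatrix ρE)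
    (ρ : OpenQuantum.HTensor HS HE →L[ℂ] OpenQuantum.HTensor HS HE)
    (hρ : ρ = OpenQuantum.opTensor ρS ρE)
    -- regularity hypotheses
    (K₀ : OpenQuantum.HTensor HS HE →ₗ.[ℂ] OpenQuantum.HTensor HS HE)
    (R K₁ : OpenQuantum.HTensor HS HE →L[ℂ] OpenQuantum.HTensor HS HE)
    (hGSE : OpenQuantum.StateFactorization ρ K₀ R K₁)
    (hHam : OpenQuantum.HamiltonianRegular 2 ham R)
    (hHam₀ : OpenQuantum.HamiltonianRegular 2 (OpenQuantum.freeHamiltonian hamS hamE) R)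
    (hS : OpenQuantum.SystemRegular S ψ)
    (hE : OpenQuantum.EnvironmentRegular E ρE)
    -- the environment has zero means
    (hmean : ∀ j, OpenQuantum.traceOp (OpenQuantum.comp (E j) (OpenQuantum.bdd ρE)) = 0)
    -- the purity of the reduced state
    (p : ℝ → ℝ) (hp : p = fun t => OpenQuantum.purity (OpenQuantum.reducedState U ρ t))
    -- the operator `V ρ V`
    (W : OpenQuantum.HTensor HS HE →ₗ.[ℂ] OpenQuantum.HTensor HS HE)
    (hW : W = OpenQuantum.comp V (OpenQuantum.comp (OpenQuantum.bdd ρ) V)) :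
    ContDiff ℝ 2 p ∧
    deriv p 0 = 0 ∧
    OpenQuantum.IsTraceClassOp W ∧
    ((deriv (deriv p) 0 : ℝ) : ℂ) = -4 * OpenQuantum.trace
      (OpenQuantum.extend W ∘L OpenQuantum.opTensor (1 - ρS) (1 : HE →L[ℂ] HE)) ∧
    ((deriv (deriv p) 0 : ℝ) : ℂ) = -4 * Matrix.trace
      (OpenQuantum.covS S ρS * (OpenQuantum.covE E ρE).transpose) ∧
    ((∃ u v : OpenQuantum.HTensor HS HE,
        u ∈ Set.range (OpenQuantum.opTensor (1 - ρS) (1 : HE →L[ℂ] HE)) ∧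
        v ∈ Set.range (OpenQuantum.opTensor (1 - ρS) (1 : HE →L[ℂ] HE)) ∧
        inner ℂ u (OpenQuantum.extend W v) ≠ 0) →
      deriv (deriv p) 0 < 0 ∧
      ∃ t₀ > 0, ∀ t, 0 < t → t < t₀ →
        OpenQuantum.IsMixedState (OpenQuantum.reducedState U ρ t)) := by
  open OpenQuantum in
  subst hρS hρ hW
  have hA := hGSE.eq_comp_adjoint.1
  have hAA := hGSE.eq_comp_adjoint.2
  obtain ⟨a, ha, rfl, hAa, hA1⟩ := hGSE.exists_root hψ hρE
  obtain ⟨F, hF, hFg⟩ := hE.exists_graph E_sa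
  choose σ hσ using fun j => LinearPMap.mem_domain_iff.mp (hS.1 j)
  have hV := V_eq.mem_graph hσ hFg
  let b := stdBasis (HTensor HS HE)
  have hD : IsHS (sumTmul σ F) := isHS_sumTmul σ hF
  rw [hAA] at hp ⊢
  obtain ⟨hp2, hp0, hp1, hpp⟩ := purity_of_interaction hamS_sa hamE_sa ham_sa ham_eq hU hψ ha hA
    hAa hA1 hHam hHam₀ hF hFg hmean hV b hp
  have hW := isBoundedExtension_sandwich V_sa (A := R ∘L K₁) (D := sumTmul σ F)
    fun y => by rw [hAa]; exact hV y
  rw [extend_eq hW]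
  have hsum := hasSum_trace_comp_opTensor b hψ hD
  have hsum' := hasSum_norm_sumTmul_sq b (fun j => (1 - proj ψ) (σ j)) hF
  simp only [← opTensor_sumTmul] at hsum'
  rw [← trace_covS_mul_covE S_sa E_sa hψ hS hσ ha hE hF hFg] at hsum'
  refine ⟨hp2, hp1, ⟨_, hW, isTraceClass_comp hD hD.adjoint⟩, ?_, ?_, ?_⟩
  · rw [hpp, ← hsum.tsum_eq]
    push_cast
    rfl
  · rw [hpp, ← hsum'.tsum_eq]
    push_cast
    rfl
  · rintro ⟨_, v, ⟨u, rfl⟩, -, huv⟩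
    have hneg : deriv (deriv p) 0 < 0 := by
      rw [hpp]
      linarith [tsum_pos_of_inner_ne_zero b hD huv]
    refine ⟨hneg, ?_⟩
    obtain ⟨ε, hε, H⟩ := exists_lt_of_deriv_deriv_neg hp2 hp1 hneg
    refine ⟨ε, hε, fun t ht htε => isMixedState_reducedState hU hA hA1 ?_⟩
    have h := H t ht htε
    rw [zero_add, hp0] at h
    rwa [hp] at h
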